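/- Let $p$ be an odd prime. Let $\mathcal Q(p)$ be the universal Steenrod algebra at $p$, i.e. the quotient of the free associative unital $\mathbb F_p$-algebra on the symbols $z_{\epsilon,k}$, $(\epsilon,k)\in\{0,1\}\times\mathbb Z$, by the two-sided ideal generated by the generalized Adem relations $R(\epsilon,k,n)$ and $S(\epsilon,k,n)$, for $(\epsilon,k,n)\in\{0,1\}\times\mathbb Z\times\mathbb N_0$, where $$R(\epsilon,k,n)=z_{\epsilon,pk-1-n}\,z_{0,k}+\sum_{j\ge 0}(-1)^j\binom{(p-1)(n-j)-1}{j}z_{\epsilon,pk-1-j}\,z_{0,k-n+j},$$ $$S(\epsilon,k,n)=z_{\epsilon,pk-n}\,z_{1,k}+\sum_{j\ge 0}(-1)^{j}\binom{(p-1)(n-j)-1}{j}z_{\epsilon,pk-j}\,z_{1,k-n+j}+(1-\epsilon)\sum_{j\ge 0}(-1)^{j+1}\binom{(p-1)(n-j)}{j}z_{1,pk-j}\,z_{0,k-n+j},$$ and a binomial coefficient $\binom{a}{j}$ with $a<0$ is taken to be $0$ (so the sums are finite). For $s\in\mathbb N_0$ put $\alpha_s=\frac{p^s-1}{p-1}$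 and let $V_s$ be the $\mathbb F_p$-vector subspace of $\mathcal Q(p)$ spanned by the set of monomials $$\mathcal U_s=\{\,z_{1,p^sh_1-\alpha_s}\,z_{0,p^sh_2-\alpha_s}\cdots z_{0,p^sh_m-\alpha_s}\mid m\ge 2,\ (h_1,\dots,h_m)\in\mathbb Z^m\,\}.$$ **Proposition.** The map $$z_{1,i_1}z_{0,i_2}\cdots z_{0,i_m}\in\mathcal U_0\ \longmapsto\ z_{1,pi_1-1}\,z_{0,pi_2-1}\cdots z_{0,pi_m-1}\in\mathcal U_0\qquad(m\ge 2,\ i_1,\dots,i_m\in\mathbb Z)$$ extends to a well-defined injective $\mathbb F_p$-linear map $\lambda:V_0\to V_0$. Moreover, $\lambda^s(V_0)=V_s\subseteq V_0$ for every $s\in\mathbb N_0$. -/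

import Mathlib

namespace UnivSteenrod

/-- The binomial coefficient `a choose j` with the convention that it vanishes for `a < 0`
(this is the convention under which the generalized Adem relations are written). -/
def binom (a : ℤ) (j : ℕ) : ℕ := if 0 ≤ a then a.toNat.choose j else 0

/-- The label set `{0,1} × ℤ` of the generators `z_{ε,k}`. -/
abbrev Label : Type := Fin 2 × ℤ

/-- The free generator `z_{ε,k}` of the free associative unital `𝔽_p`-algebra. -/
noncomputable def gen (p : ℕ) (ε : Fin 2) (k : ℤ) : FreeAlgebra (ZMod p) Label :=
  FreeAlgebra.ι (ZMod p) (ε, k)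

/-- The polynomial
`R(ε,k,n) = z_{ε,pk-1-n} z_{0,k} + ∑_j (-1)^j ((p-1)(n-j)-1 choose j) z_{ε,pk-1-j} z_{0,k-n+j}`.
The summands with `j > n` vanish, see `binom_R_eq_zero`. -/
noncomputable def relR (p : ℕ) (ε : Fin 2) (k : ℤ) (n : ℕ) : FreeAlgebra (ZMod p) Label :=
  gen p ε (p * k - 1 - n) * gen p 0 k
    + ∑ j ∈ Finset.range (n + 1),
        ((-1 : ZMod p) ^ j * (binom (((p : ℤ) - 1) * ((n : ℤ) - j) - 1) j : ZMod p)) •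
          (gen p ε (p * k - 1 - j) * gen p 0 (k - n + j))

/-- The polynomial
`S(ε,k,n) = z_{ε,pk-n} z_{1,k} + ∑_j (-1)^j ((p-1)(n-j)-1 choose j) z_{ε,pk-j} z_{1,k-n+j}
  + (1-ε) ∑_j (-1)^(j+1) ((p-1)(n-j) choose j) z_{1,pk-j} z_{0,k-n+j}`.
The signs are those of the Adem relation for `P^a β P^b` (with `a = pk-n`, `b = k`):
`P^a β P^b = ∑_t (-1)^(a+t) ((p-1)(b-t) choose a-pt) β P^(a+b-t) P^t
  + ∑_t (-1)^(a+t-1) ((p-1)(b-t)-1 choose a-pt-1) P^(a+b-t) β P^t`, where `t = k-n+j`.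
The summands with `j > n` vanish, see `binom_R_eq_zero` and `binom_S_eq_zero`. -/
noncomputable def relS (p : ℕ) (ε : Fin 2) (k : ℤ) (n : ℕ) : FreeAlgebra (ZMod p) Label :=
  gen p ε (p * k - n) * gen p 1 k
    + ∑ j ∈ Finset.range (n + 1),
        ((-1 : ZMod p) ^ j * (binom (((p : ℤ) - 1) * ((n : ℤ) - j) - 1) j : ZMod p)) •
          (gen p ε (p * k - j) * gen p 1 (k - n + j))
    + (1 - ((ε : ℕ) : ZMod p)) • ∑ j ∈ Finset.range (n + 1),
        ((-1 : ZMod p) ^ (j + 1) * (binom (((p : ℤ) - 1) * ((n : ℤ) - j)) j : ZMod p)) •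
          (gen p 1 (p * k - j) * gen p 0 (k - n + j))

theorem binom_R_eq_zero (p : ℕ) (hp : 2 ≤ p) (n j : ℕ) (h : n < j) :
    binom (((p : ℤ) - 1) * ((n : ℤ) - j) - 1) j = 0 := by
  have : ¬ (0 ≤ ((p : ℤ) - 1) * ((n : ℤ) - j) - 1) := by
    have h1 : (0 : ℤ) < (p : ℤ) - 1 := by omega
    have h2 : (n : ℤ) - j < 0 := by omega
    nlinarith
  simp only [binom, this, if_false]

theorem binom_S_eq_zero (p : ℕ) (hp : 2 ≤ p) (n j : ℕ) (h : n < j) :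
    binom (((p : ℤ) - 1) * ((n : ℤ) - j)) j = 0 := by
  have : ¬ (0 ≤ ((p : ℤ) - 1) * ((n : ℤ) - j)) := by
    have h1 : (0 : ℤ) < (p : ℤ) - 1 := by omega
    have h2 : (n : ℤ) - j < 0 := by omega
    nlinarith
  simp only [binom, this, if_false]

/-- The generalized Adem relations: `R(ε,k,n) = 0` and `S(ε,k,n) = 0`. -/
inductive AdemRel (p : ℕ) : FreeAlgebra (ZMod p) Label → FreeAlgebra (ZMod p) Label → Prop
  | R (ε : Fin 2) (k : ℤ) (n : ℕ) : AdemRel p (relR p ε k n) 0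
  | S (ε : Fin 2) (k : ℤ) (n : ℕ) : AdemRel p (relS p ε k n) 0

/-- The universal Steenrod algebra `𝒬(p)` (for `p` an odd prime): the quotient of the free
`𝔽_p`-algebra on the `z_{ε,k}` by the two-sided ideal of the generalized Adem relations. -/
abbrev Q (p : ℕ) : Type := RingQuot (AdemRel p)

/-- The class of `z_{ε,k}` in `𝒬(p)`. -/
noncomputable def z (p : ℕ) (ε : Fin 2) (k : ℤ) : Q p :=
  RingQuot.mkAlgHom (ZMod p) (AdemRel p) (gen p ε k)

/-- The monomial `z_{1,i} z_{0,t_1} ⋯ z_{0,t_r}` of `𝒬(p)`, where `t = [t_1, …, t_r]`. -/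
noncomputable def mono (p : ℕ) (i : ℤ) (t : List ℤ) : Q p :=
  z p 1 i * (t.map (z p 0)).prod

/-- `α_s = (p^s - 1) / (p - 1)` (an exact division, see `alpha_mul`; in particular `α_0 = 0`). -/
def alpha (p s : ℕ) : ℤ := ((p : ℤ) ^ s - 1) / ((p : ℤ) - 1)

theorem alpha_mul (p s : ℕ) : alpha p s * ((p : ℤ) - 1) = (p : ℤ) ^ s - 1 :=
  Int.ediv_mul_cancel (sub_one_dvd_pow_sub_one (p : ℤ) s)

/-- The set `𝒰_s` of the monomials `z_{1,p^s h_1-α_s} z_{0,p^s h_2-α_s} ⋯ z_{0,p^s h_m-α_s}` with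
`m ≥ 2` and `h_1, …, h_m ∈ ℤ`; here `h = h_1` and `t = [h_2, …, h_m]` is a non-empty list. -/
def U (p s : ℕ) : Set (Q p) :=
  {x | ∃ (h : ℤ) (t : List ℤ), t ≠ [] ∧
    x = mono p ((p : ℤ) ^ s * h - alpha p s) (t.map fun k => (p : ℤ) ^ s * k - alpha p s)}

/-- The `𝔽_p`-subspace `V_s` of `𝒬(p)` generated by `𝒰_s`. -/
def V (p s : ℕ) : Submodule (ZMod p) (Q p) := Submodule.span (ZMod p) (U p s)

theorem mono_mem_V_zero (p : ℕ) (i : ℤ) (t : List ℤ) (ht : t ≠ []) : mono p i t ∈ V p 0 :=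
  Submodule.subset_span ⟨i, t, ht, by simp [alpha]⟩

end UnivSteenrod

/-!
The words of length `m` are encoded by Laurent monomials: the word with indices `i_0, …, i_{m-1}`
is `x_0 ^ (-i_0) ⋯ x_{m-1} ^ (-i_{m-1})`. For two neighbouring letters `x = x_s`, `y = x_{s+1}`,
the relation `R(ε,k,n)` becomes `(x ^ p y) ^ (-k) * x * r_n`, where the polynomials `r_n`
(`ademPoly`) have generating series `1 / (1 - (x + y) t + x ^ p y t ^ (p + 1))` modulo `p`
(`add_mul_ademPoly`). Hence the relations at the positions `s`, `s + 1` span `x_s · A_s`, with `A_s`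
(`pairAlg`) the algebra generated by `x_s + x_{s+1}`, `(x_s ^ p x_{s+1})^{±1}` and the other
variables with their inverses; the relations in length `m` are `N_m = ∑_s x_s A_s` (`relations`).

*`V_0` in length `m` is the space of Laurent polynomials modulo `N_m`.* The relations `R` show that
`N_m` maps to zero (`lin_evalMon_eq_zero`). Conversely, the relations `S` cause no further relations
among the monomials of `V_0`: send a word to its Laurent monomial if exactly one of its
letters has `ε = 1`, irrespective of the position of that letter, and to zero otherwise. Then
`S(1,k,n)` goes to zero, and `S(0,k,n)` goes to `(x ^ p y) ^ (-k) * (r_n - r'_n)`, where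
`r_n - r'_n = x r_{n-1}` by Pascal's rule (`ademPoly'_succ`), so it goes into `N_m`
(`freeVal_mem_of_mk_eq_zero`).

*The map `λ`.* It becomes `f ↦ f ^ p * x_0 ⋯ x_{m-1}`, which preserves `N_m` since
`x_s ^ p x_{s+1}` lies in `A_s` (`pow_mul_mem_relations`). So `λ` is well defined.

*Injectivity.* The Cartier operator `C`, with `C (g ^ p f) = g C(f)`, preserves `N_m` as well
(`cartier_mem_relations`). The `(p-1)`-st power `d` of the product of analogues of the Dickson
invariants (`dickson`) lies in the intersection of the `A_s`, and `C (d x_0 ⋯ x_{m-1})` is a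
monomial `c` that is invertible in all `A_s` (`cartier_dicksonProd_mul`). Therefore
`C (d λ(f)) = f c`, and `λ(f) ∈ N_m` implies `f ∈ N_m` (`mem_relations_of_pow_mul`).
-/

namespace UnivSteenrod

/-! ### Binomial coefficients and the Adem relations as polynomials -/

theorem binom_natCast (a j : ℕ) : binom (a : ℤ) j = a.choose j := by simp [binom]

theorem binom_of_neg {a : ℤ} (ha : a < 0) (j : ℕ) : binom a j = 0 := by
  simp [binom, not_le.mpr ha]

theorem binom_succ_succ (a : ℤ) (j : ℕ) : binom (a + 1) (j + 1) = binom a j + binom a (j + 1) := by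
  rcases lt_or_ge a 0 with ha | ha
  · rw [binom_of_neg ha, binom_of_neg ha]
    rcases (show a + 1 = 0 ∨ a + 1 < 0 by omega) with h | h
    · simp [binom, h]
    · rw [binom_of_neg h]
  · lift a to ℕ using ha
    exact_mod_cast Nat.choose_succ_succ a j

section Frobenius

variable {p : ℕ} [Fact p.Prime]

/-- Vandermonde with `(1 + t) ^ p = 1 + t ^ p` in characteristic `p`. -/
theorem binom_add_prime {a : ℤ} (ha : 0 ≤ a) (j : ℕ) :
    (binom (a + p) j : ZMod p) = binom a j + if p ≤ j then (binom a (j - p) : ZMod p) else 0 := by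
  lift a to ℕ using ha
  have h : ((Polynomial.X + 1) ^ (a + p) : Polynomial (ZMod p))
      = (Polynomial.X + 1) ^ a + (Polynomial.X + 1) ^ a * Polynomial.X ^ p := by
    rw [pow_add, add_pow_char (p := p)]
    ring
  have hj := congrArg (fun f => Polynomial.coeff f j) h
  simp only [Polynomial.coeff_add, Polynomial.coeff_X_add_one_pow,
    Polynomial.coeff_mul_X_pow'] at hj
  rw [← Nat.cast_add, binom_natCast, binom_natCast, binom_natCast, hj]

theorem choose_prime_sub_one {j : ℕ} (hj : j < p) :
    ((p - 1).choose j : ZMod p) = (-1) ^ j := by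
  have hp := (Fact.out : p.Prime).pos
  induction j with
  | zero => simp
  | succ j ih =>
    have h := Nat.choose_succ_succ' (p - 1) j
    rw [Nat.sub_add_cancel hp] at h
    have h0 : (p.choose (j + 1) : ZMod p) = 0 :=
      (ZMod.natCast_eq_zero_iff _ _).2 ((Fact.out : p.Prime).dvd_choose_self (by omega) hj)
    rw [h] at h0
    push_cast at h0
    rw [pow_succ, ← ih (by omega)]
    linear_combination h0

/-- The coefficient `(-1)^j ((p-1)(n-j)-1 choose j)` of `R(ε,k,n)` and of the
first sum of `S(ε,k,n)`. -/
def ademCoeff (p n j : ℕ) : ZMod p :=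
  (-1) ^ j * (binom (((p : ℤ) - 1) * ((n : ℤ) - j) - 1) j : ZMod p)

/-- The coefficient `(-1)^j ((p-1)(n-j) choose j)`, up to sign that of the last sum of
`S(0,k,n)`. -/
def ademCoeff' (p n j : ℕ) : ZMod p :=
  (-1) ^ j * (binom (((p : ℤ) - 1) * ((n : ℤ) - j)) j : ZMod p)

theorem ademCoeff_eq_zero {n j : ℕ} (h : n ≤ j) : ademCoeff p n j = 0 := by
  have : (2 : ℤ) ≤ p := by exact_mod_cast (Fact.out : p.Prime).two_le
  have h' : (n : ℤ) ≤ j := by exact_mod_cast h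
  rw [ademCoeff, binom_of_neg (by nlinarith)]
  simp

theorem ademCoeff'_succ (n j : ℕ) :
    ademCoeff' p (n + 1) (j + 1) = ademCoeff p (n + 1) (j + 1) - ademCoeff p n j := by
  have h := binom_succ_succ (((p : ℤ) - 1) * ((n : ℤ) - j) - 1) j
  rw [sub_add_cancel] at h
  simp only [ademCoeff', ademCoeff]
  push_cast
  rw [show ((n : ℤ) + 1 - (j + 1)) = n - j by ring, h]
  push_cast
  ring

theorem ademCoeff_succ_zero (n : ℕ) : ademCoeff p (n + 1) 0 = 1 := by
  have : (2 : ℤ) ≤ p := by exact_mod_cast (Fact.out : p.Prime).two_le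
  have h : (0 : ℤ) ≤ ((p : ℤ) - 1) * (((n + 1 : ℕ) : ℤ) - (0 : ℕ)) - 1 := by
    push_cast
    nlinarith
  simp only [ademCoeff, binom, if_pos h]
  simp

theorem ademCoeff'_zero (n : ℕ) : ademCoeff' p n 0 = 1 := by
  have : (2 : ℤ) ≤ p := by exact_mod_cast (Fact.out : p.Prime).two_le
  have h : (0 : ℤ) ≤ ((p : ℤ) - 1) * ((n : ℤ) - (0 : ℕ)) := by
    apply mul_nonneg <;> push_cast <;> omega
  simp only [ademCoeff', binom, if_pos h]
  simp

/-- Pascal's rule and `binom_add_prime`, written for the coefficients of the Adem relations. The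
two correction terms account for the leading monomials of the relations. -/
theorem ademCoeff_rec (hp : p ≠ 2) (n j : ℕ) :
    ademCoeff p n j + ademCoeff p n (j + 1) + (if j + 1 = n then 1 else 0) =
      ademCoeff p (n + 1) (j + 1)
        + (if p ≤ n then (if p ≤ j + 1 then ademCoeff p (n - p) (j + 1 - p) else 0)
            + (if j + 1 = n then 1 else 0) else 0) := by
  have hpr : p.Prime := Fact.out
  have hp2 : (2 : ℤ) ≤ p := by exact_mod_cast hpr.two_le
  have hodd : ((-1 : ZMod p)) ^ p = -1 := (hpr.odd_of_ne_two hp).neg_one_pow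
  set a : ℤ := ((p : ℤ) - 1) * ((n : ℤ) - (j + 1)) - 1 with ha
  have e1 : ademCoeff p n j = (-1) ^ j * (binom (a + p - 1) j : ZMod p) := by
    rw [ademCoeff, ha]; congr 3; ring
  have e2 : ademCoeff p n (j + 1) = (-1) ^ (j + 1) * (binom a (j + 1) : ZMod p) := by
    rw [ademCoeff, ha]; push_cast; rfl
  have e3 : ademCoeff p (n + 1) (j + 1)
      = (-1) ^ (j + 1) * (binom (a + p - 1) (j + 1) : ZMod p) := by
    rw [ademCoeff, ha]; congr 3; push_cast; ring
  have e4 : p ≤ n → p ≤ j + 1 → ademCoeff p (n - p) (j + 1 - p)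
      = -((-1) ^ (j + 1) * (binom a (j + 1 - p) : ZMod p)) := by
    intro h1 h2
    have : ((-1 : ZMod p)) ^ (j + 1) = -(-1) ^ (j + 1 - p) := by
      conv_lhs => rw [← Nat.sub_add_cancel h2, pow_add, hodd]
      ring
    rw [this, ademCoeff, ha, Nat.cast_sub h1, Nat.cast_sub h2]
    push_cast
    rw [show ((n : ℤ) - p - (j + 1 - p)) = n - (j + 1) by ring]
    ring
  have hpas : (binom (a + p) (j + 1) : ZMod p)
      = binom (a + p - 1) j + binom (a + p - 1) (j + 1) := by
    have := binom_succ_succ (a + p - 1) j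
    rw [sub_add_cancel] at this
    exact_mod_cast congrArg (Nat.cast (R := ZMod p)) this
  rcases lt_trichotomy (j + 1) n with h | h | h
  · have ha0 : 0 ≤ a := by
      have : (j : ℤ) + 1 + 1 ≤ n := by exact_mod_cast h
      nlinarith
    have hf := binom_add_prime ha0 (j + 1) (p := p)
    rw [hpas] at hf
    rw [e1, e2, e3, if_neg h.ne]
    by_cases h2 : p ≤ j + 1
    · have h1 : p ≤ n := by omega
      rw [if_pos h1, if_pos h2, e4 h1 h2]
      rw [if_pos h2] at hf
      linear_combination (-(-1 : ZMod p) ^ (j + 1)) * hf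
    · rw [if_neg h2] at hf
      simp only [if_neg h2, add_zero, ite_self]
      linear_combination (-(-1 : ZMod p) ^ (j + 1)) * hf
  · have ha1 : a = -1 := by
      have : (n : ℤ) = j + 1 := by exact_mod_cast h.symm
      rw [ha, this]; ring
    have hz : ademCoeff p n (j + 1) = 0 := ademCoeff_eq_zero h.ge
    rw [e1, hz, e3, if_pos h]
    have hc : (a + p) = ((p - 1 : ℕ) : ℤ) := by
      rw [ha1, Nat.cast_sub hpr.one_le]; push_cast; ring
    have hb : binom (a + p) (j + 1) = (p - 1).choose (j + 1) := by rw [hc, binom_natCast]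
    rw [hb] at hpas
    have hs : (-1 : ZMod p) ^ (j + 1) * (-1) ^ (j + 1) = 1 := by rw [← mul_pow]; simp
    by_cases h1 : p ≤ n
    · rw [if_pos h1, if_pos (h ▸ h1), ademCoeff_eq_zero (by omega)]
      rw [Nat.choose_eq_zero_of_lt (by omega)] at hpas
      linear_combination (norm := (push_cast; ring)) (-(-1 : ZMod p) ^ j) * hpas
    · rw [if_neg h1]
      rw [choose_prime_sub_one (by omega)] at hpas
      linear_combination (norm := (push_cast; ring)) (-1 : ZMod p) ^ (j + 1) * hpas - hs
  · rw [ademCoeff_eq_zero (show n ≤ j by omega), ademCoeff_eq_zero (show n ≤ j + 1 by omega),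
      ademCoeff_eq_zero (show n + 1 ≤ j + 1 by omega), if_neg h.ne']
    have : p ≤ n → ademCoeff p (n - p) (j + 1 - p) = 0 := fun h1 => ademCoeff_eq_zero (by omega)
    by_cases h1 : p ≤ n
    · rw [if_pos h1, this h1]; simp
    · simp [h1]

variable {R : Type*} [CommRing R] [Algebra (ZMod p) R]

/-- The Adem relation `R(ε,k,n)` as a polynomial in two variables, up to a monomial factor. -/
def ademPoly (n : ℕ) (x y : R) : R :=
  x ^ n + ∑ j ∈ Finset.range (n + 1), ademCoeff p n j • (x ^ j * y ^ (n - j))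

/-- The last sum of `S(0,k,n)` as a polynomial in two variables, up to sign and a monomial
factor. -/
def ademPoly' (n : ℕ) (x y : R) : R :=
  ∑ j ∈ Finset.range (n + 1), ademCoeff' p n j • (x ^ j * y ^ (n - j))

theorem ademPoly_zero (x y : R) : ademPoly (p := p) 0 x y = 1 := by
  simp [ademPoly, ademCoeff_eq_zero]

theorem ademPoly'_zero (x y : R) : ademPoly' (p := p) 0 x y = 1 := by
  simp [ademPoly', ademCoeff'_zero]

theorem ademPoly'_succ (n : ℕ) (x y : R) :
    ademPoly' (p := p) (n + 1) x y
      = ademPoly (p := p) (n + 1) x y - x * ademPoly (p := p) n x y := by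
  simp only [ademPoly', ademPoly, mul_add, Finset.mul_sum]
  rw [Finset.sum_range_succ', Finset.sum_range_succ' _ (n + 1)]
  simp only [ademCoeff'_succ, sub_smul, Finset.sum_sub_distrib, ademCoeff'_zero,
    ademCoeff_succ_zero, Nat.add_sub_add_right, mul_smul_comm]
  have : ∀ j, x * (x ^ j * y ^ (n - j)) = x ^ (j + 1) * y ^ (n - j) := fun j => by ring
  simp only [this]
  ring

/-- The polynomials `ademPoly n` satisfy the linear recursion of the series
`1 / (1 - (x + y) t + x ^ p y t ^ (p + 1))`. -/
theorem add_mul_ademPoly (hp : p ≠ 2) (n : ℕ) (x y : R) :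
    (x + y) * ademPoly (p := p) n x y = ademPoly (p := p) (n + 1) x y
      + if p ≤ n then x ^ p * y * ademPoly (p := p) (n - p) x y else 0 := by
  have hpr : p.Prime := Fact.out
  have h1 : x * ademPoly (p := p) n x y = x ^ (n + 1)
      + ∑ j ∈ Finset.range (n + 1), ademCoeff p n j • (x ^ (j + 1) * y ^ (n - j)) := by
    simp only [ademPoly, mul_add, Finset.mul_sum, mul_smul_comm]
    congr 1
    · ring
    · exact Finset.sum_congr rfl fun j _ => by congr 1; ring
  have h2 : y * ademPoly (p := p) n x y = x ^ n * y
      + ∑ j ∈ Finset.range (n + 1), ademCoeff p n (j + 1) • (x ^ (j + 1) * y ^ (n - j))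
      + ademCoeff p n 0 • y ^ (n + 1) := by
    have : ∑ j ∈ Finset.range (n + 1), ademCoeff p n j • (x ^ j * y ^ (n + 1 - j))
        = ∑ j ∈ Finset.range (n + 1), ademCoeff p n (j + 1) • (x ^ (j + 1) * y ^ (n - j))
          + ademCoeff p n 0 • y ^ (n + 1) := by
      have h := Finset.sum_range_succ (fun j => ademCoeff p n j • (x ^ j * y ^ (n + 1 - j))) (n + 1)
      rw [ademCoeff_eq_zero (by omega), zero_smul, add_zero] at h
      rw [← h, Finset.sum_range_succ']
      simp
    rw [add_assoc, ← this]
    simp only [ademPoly, mul_add, Finset.mul_sum, mul_smul_comm]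
    congr 1
    · ring
    · refine Finset.sum_congr rfl fun j hj => ?_
      rw [Nat.sub_add_comm (Nat.lt_succ_iff.1 (Finset.mem_range.1 hj))]
      congr 1
      ring
  have h3 : ademPoly (p := p) (n + 1) x y = x ^ (n + 1)
      + ∑ j ∈ Finset.range (n + 1), ademCoeff p (n + 1) (j + 1) • (x ^ (j + 1) * y ^ (n - j))
      + y ^ (n + 1) := by
    rw [ademPoly, Finset.sum_range_succ', Finset.sum_range_succ]
    simp [ademCoeff_succ_zero, ademCoeff_eq_zero, Finset.sum_range_succ, add_assoc]
  have h4 : p ≤ n → x ^ p * y * ademPoly (p := p) (n - p) x y = x ^ n * y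
      + ∑ j ∈ Finset.range (n + 1),
        (if p ≤ j + 1 then ademCoeff p (n - p) (j + 1 - p) else 0)
          • (x ^ (j + 1) * y ^ (n - j)) := by
    intro hn
    have hs : ∑ j ∈ Finset.range (n + 1),
        (if p ≤ j + 1 then ademCoeff p (n - p) (j + 1 - p) else 0)
          • (x ^ (j + 1) * y ^ (n - j))
        = ∑ i ∈ Finset.range (n - p + 1), ademCoeff p (n - p) i
          • (x ^ (p + i) * y ^ (n - p - i + 1)) := by
      obtain ⟨m, rfl⟩ := Nat.exists_eq_add_of_le hn
      obtain ⟨q, hq⟩ := Nat.exists_eq_succ_of_ne_zero hpr.ne_zero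
      have e : p + m + 1 = q + (m + 1 + 1) := by omega
      rw [e, Finset.sum_range_add, Finset.sum_eq_zero, zero_add, Finset.sum_range_succ,
        ademCoeff_eq_zero (show p + m - p ≤ q + (m + 1) + 1 - p by omega)]
      · simp only [ite_self, zero_smul, add_zero, Nat.add_sub_cancel_left]
        refine Finset.sum_congr rfl fun i hi => ?_
        rw [Finset.mem_range] at hi
        rw [if_pos (by omega), show q + i + 1 = p + i by omega, Nat.add_sub_cancel_left,
          show p + m - (q + i) = m - i + 1 by omega]
      · intro j hj
        rw [Finset.mem_range] at hj
        rw [if_neg (by omega), zero_smul]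
    rw [hs]
    simp only [ademPoly, mul_add, Finset.mul_sum, mul_smul_comm]
    congr 1
    · rw [mul_right_comm, ← pow_add, Nat.add_sub_cancel' hn]
    · exact Finset.sum_congr rfl fun j _ => by congr 1; ring
  have hrec := ademCoeff_rec (p := p) hp n
  have h0 : ademCoeff p n 0 • y ^ (n + 1) + (if n = 0 then y else 0) = y ^ (n + 1) := by
    rcases n with _ | n
    · simp [ademCoeff_eq_zero]
    · simp [ademCoeff_succ_zero]
  -- The monomial `x ^ n * y`, which is the summand of index `n - 1` if `n` is positive.
  have hlead : x ^ n * y = (∑ j ∈ Finset.range (n + 1),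
      (if j + 1 = n then (1 : ZMod p) else 0) • (x ^ (j + 1) * y ^ (n - j)))
      + if n = 0 then y else 0 := by
    rcases n with _ | n
    · simp
    · simp [ite_smul]
  have hsum : ∑ j ∈ Finset.range (n + 1), (ademCoeff p n j + ademCoeff p n (j + 1)
      + (if j + 1 = n then 1 else 0)) • (x ^ (j + 1) * y ^ (n - j))
      = ∑ j ∈ Finset.range (n + 1), (ademCoeff p (n + 1) (j + 1)
        + (if p ≤ n then (if p ≤ j + 1 then ademCoeff p (n - p) (j + 1 - p) else 0)
            + (if j + 1 = n then 1 else 0) else 0)) • (x ^ (j + 1) * y ^ (n - j)) :=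
    Finset.sum_congr rfl fun j _ => by rw [hrec]
  rw [add_mul, h1, h2, h3]
  by_cases hn : p ≤ n
  · have hn0 : n ≠ 0 := fun h => hpr.ne_zero (by omega)
    simp only [if_pos hn, add_smul, Finset.sum_add_distrib] at hsum
    simp only [if_neg hn0, add_zero] at hlead h0
    rw [if_pos hn, h4 hn]
    linear_combination hsum + h0
  · simp only [if_neg hn, add_smul, Finset.sum_add_distrib, add_zero] at hsum
    rw [if_neg hn, hlead]
    linear_combination hsum + h0

end Frobenius

/-! ### Laurent polynomials -/

/-- Laurent polynomials over `𝔽_p` in the variables `x_0, x_1, …`, as the group algebra of the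
exponents `ℕ → ℤ` (exponents of infinite support are allowed, but play no role). The word with
indices `i_0, …, i_{m-1}` corresponds to the monomial with exponents `-i_0, …, -i_{m-1}`. -/
abbrev Laurent (p : ℕ) : Type := AddMonoidAlgebra (ZMod p) (ℕ → ℤ)

namespace Laurent

variable {p : ℕ}

/-- The Laurent monomial with exponents `e`. -/
noncomputable def X (e : ℕ → ℤ) : Laurent p := AddMonoidAlgebra.single e 1

/-- The variable `x_j`. -/
noncomputable def x (j : ℕ) : Laurent p := X (Pi.single j 1)

theorem X_zero : (X 0 : Laurent p) = 1 := rfl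

theorem X_mul (e f : ℕ → ℤ) : (X e * X f : Laurent p) = X (e + f) := by
  simp [X, AddMonoidAlgebra.single_mul_single]

theorem X_pow (e : ℕ → ℤ) (n : ℕ) : (X e ^ n : Laurent p) = X (n • e) := by
  simp [X, AddMonoidAlgebra.single_pow]

theorem x_pow (j n : ℕ) : (x j ^ n : Laurent p) = X (Pi.single j (n : ℤ)) := by
  rw [x, X_pow]
  congr 1
  ext i
  rcases eq_or_ne i j with rfl | h <;> simp [*]

/-- The linear map given by its values on the monomials. -/
noncomputable def lin {V : Type*} [AddCommGroup V] [Module (ZMod p) V] (g : (ℕ → ℤ) → V) :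
    Laurent p →ₗ[ZMod p] V :=
  Finsupp.linearCombination (ZMod p) g ∘ₗ
    (AddMonoidAlgebra.coeffLinearEquiv (ZMod p) : Laurent p ≃ₗ[ZMod p] _).toLinearMap

theorem lin_X {V : Type*} [AddCommGroup V] [Module (ZMod p) V] (g : (ℕ → ℤ) → V) (e : ℕ → ℤ) :
    lin g (X e : Laurent p) = g e := by
  simp [lin, X]

@[elab_as_elim]
theorem induction {P : Laurent p → Prop} (f : Laurent p) (hX : ∀ e, P (X e))
    (hadd : ∀ f g, P f → P g → P (f + g)) (hsmul : ∀ (c : ZMod p) f, P f → P (c • f)) : P f :=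
  AddMonoidAlgebra.induction_on f hX (fun f g => hadd f g)
    (fun c f => hsmul c f)

/-! ### Invariants of a pair of neighbouring variables -/

/-- The algebra of Laurent polynomials generated by the variables other than `x_s` and `x_{s+1}`
and their inverses, together with `x_s + x_{s+1}` and `(x_s ^ p x_{s+1})^{±1}`. -/
noncomputable def pairAlg (p s : ℕ) : Subalgebra (ZMod p) (Laurent p) :=
  Algebra.adjoin (ZMod p)
    ({x s + x (s + 1)} ∪ {f | ∃ e : ℕ → ℤ, e s = p * e (s + 1) ∧ f = X e})

theorem add_mem_pairAlg (s : ℕ) : (x s + x (s + 1) : Laurent p) ∈ pairAlg p s :=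
  Algebra.subset_adjoin (Or.inl rfl)

theorem X_mem_pairAlg {s : ℕ} {e : ℕ → ℤ} (h : e s = p * e (s + 1)) :
    (X e : Laurent p) ∈ pairAlg p s :=
  Algebra.subset_adjoin (Or.inr ⟨e, h, rfl⟩)

theorem x_mem_pairAlg {s j : ℕ} (h : j ≠ s) (h' : j ≠ s + 1) :
    (x j : Laurent p) ∈ pairAlg p s :=
  X_mem_pairAlg (by simp [h.symm, h'.symm])

theorem pow_mul_mem_pairAlg (s : ℕ) : (x s ^ p * x (s + 1) : Laurent p) ∈ pairAlg p s := by
  rw [x_pow, x, X_mul]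
  exact X_mem_pairAlg (by simp)

/-- `pairAlg s` is spanned by the products of a monomial and a power of `x_s + x_{s+1}`. -/
theorem pairAlg_induction {s : ℕ} {P : Laurent p → Prop} {f : Laurent p} (hf : f ∈ pairAlg p s)
    (hX : ∀ (e : ℕ → ℤ) (n : ℕ), e s = p * e (s + 1) → P (X e * (x s + x (s + 1)) ^ n))
    (h0 : P 0) (hadd : ∀ f g, P f → P g → P (f + g))
    (hsmul : ∀ (c : ZMod p) f, P f → P (c • f)) : P f := by
  let G : Set (Laurent p) :=
    {f | ∃ (e : ℕ → ℤ) (n : ℕ), e s = p * e (s + 1) ∧ f = X e * (x s + x (s + 1)) ^ n}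
  have hG : ∀ f ∈ Submodule.span (ZMod p) G, ∀ g ∈ Submodule.span (ZMod p) G,
      f * g ∈ Submodule.span (ZMod p) G := by
    intro f hf g hg
    have := Submodule.mul_mem_mul hf hg
    rw [Submodule.span_mul_span] at this
    refine Submodule.span_mono ?_ this
    rintro _ ⟨_, ⟨e, n, he, rfl⟩, _, ⟨e', n', he', rfl⟩, rfl⟩
    refine ⟨e + e', n + n', by simp [he, he', mul_add], ?_⟩
    rw [← X_mul, pow_add]
    ring
  have : f ∈ Submodule.span (ZMod p) G := by
    clear hX h0 hadd hsmul
    unfold pairAlg at hf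
    induction hf using Algebra.adjoin_induction with
    | mem f hf =>
      apply Submodule.subset_span
      rcases hf with rfl | ⟨e, he, rfl⟩
      · exact ⟨0, 1, by simp, by simp [X_zero]⟩
      · exact ⟨e, 0, he, by simp⟩
    | algebraMap c =>
      rw [Algebra.algebraMap_eq_smul_one]
      exact Submodule.smul_mem _ _ (Submodule.subset_span ⟨0, 0, by simp, by simp [X_zero]⟩)
    | add f g _ _ hf hg => exact add_mem hf hg
    | mul f g _ _ hf hg => exact hG f hf g hg
  refine Submodule.span_induction (p := fun f _ => P f) ?_ h0 (fun f g _ _ => hadd f g)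
    (fun c f _ => hsmul c f) this
  rintro _ ⟨e, n, he, rfl⟩
  exact hX e n he

/-- The submodule `x_s · pairAlg p s`. It is the space of the relations `R(ε,k,n)` applied to the
letters in positions `s` and `s + 1` of a word. -/
noncomputable def pairRel (p s : ℕ) : Submodule (ZMod p) (Laurent p) :=
  (pairAlg p s).toSubmodule.map (LinearMap.mulLeft (ZMod p) (x s))

theorem x_mul_mem_pairRel {s : ℕ} {f : Laurent p} (hf : f ∈ pairAlg p s) :
    x s * f ∈ pairRel p s := ⟨f, hf, rfl⟩

theorem mul_mem_pairRel {s : ℕ} {a f : Laurent p} (ha : a ∈ pairAlg p s) (hf : f ∈ pairRel p s) :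
    a * f ∈ pairRel p s := by
  obtain ⟨f, hf, rfl⟩ := hf
  exact ⟨a * f, Subalgebra.mul_mem _ ha hf, mul_left_comm _ _ _⟩

/-- The exponents of the monomial `x_0 ⋯ x_{m-1}`. -/
def allOnes (m : ℕ) : ℕ → ℤ := fun j => if j < m then 1 else 0

theorem X_allOnes_succ (m : ℕ) : (X (allOnes (m + 1)) : Laurent p) = X (allOnes m) * x m := by
  rw [x, X_mul]
  congr 1
  ext j
  rcases lt_trichotomy j m with h | rfl | h
  · simp [allOnes, h, h.ne, Nat.lt_succ_of_lt h]
  · simp [allOnes]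
  · simp [allOnes, h.ne', not_lt.2 h.le, show ¬ j < m + 1 by omega]

theorem X_allOnes (m : ℕ) : (X (allOnes m) : Laurent p) = ∏ i ∈ Finset.range m, x i := by
  induction m with
  | zero => exact X_zero
  | succ m ih => rw [X_allOnes_succ, ih, Finset.prod_range_succ]

/-- The relations among words of length `m`, as Laurent polynomials. -/
noncomputable def relations (p m : ℕ) : Submodule (ZMod p) (Laurent p) :=
  ⨆ s : {s : ℕ // s + 1 < m}, pairRel p s

theorem pairRel_le_relations {m s : ℕ} (h : s + 1 < m) : pairRel p s ≤ relations p m :=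
  le_iSup (fun s : {s : ℕ // s + 1 < m} => pairRel p s) ⟨s, h⟩

theorem relations_induction {m : ℕ} {P : Laurent p → Prop} {f : Laurent p}
    (hf : f ∈ relations p m) (hs : ∀ s, s + 1 < m → ∀ f ∈ pairRel p s, P f) (h0 : P 0)
    (hadd : ∀ f g, P f → P g → P (f + g)) : P f :=
  Submodule.iSup_induction _ (motive := P) hf (fun s f hf => hs s s.2 f hf) h0 hadd

theorem mul_mem_relations {m : ℕ} {a f : Laurent p} (ha : ∀ s, s + 1 < m → a ∈ pairAlg p s)
    (hf : f ∈ relations p m) : a * f ∈ relations p m := by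
  refine relations_induction (P := fun f => a * f ∈ relations p m) hf
    (fun s h f hf => pairRel_le_relations h (mul_mem_pairRel (ha s h) hf)) (by simp) ?_
  intro f g hf hg
  simpa [mul_add] using add_mem hf hg

variable [Fact p.Prime]

instance instCharP : CharP (Laurent p) p := charP_of_injective_algebraMap' (ZMod p) p

theorem smul_pow_char (c : ZMod p) (f : Laurent p) : (c • f) ^ p = c • f ^ p := by
  rw [smul_pow, ZMod.pow_card]

/-! ### Cartier operator -/

/-- The Cartier operator: it keeps the monomials whose exponents are all divisible by `p` and
divides these exponents by `p`. -/
noncomputable def cartier : Laurent p →ₗ[ZMod p] Laurent p :=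
  open Classical in lin fun e => if ∃ f : ℕ → ℤ, e = p • f then X (fun j => e j / p) else 0

theorem cartier_X_smul (f : ℕ → ℤ) : cartier (X (p • f) : Laurent p) = X f := by
  have hp : (p : ℤ) ≠ 0 := by exact_mod_cast (Fact.out : p.Prime).ne_zero
  rw [cartier, lin_X, if_pos ⟨f, rfl⟩]
  congr 1
  ext j
  simp [Int.mul_ediv_cancel_left _ hp]

theorem cartier_X_eq_zero {e : ℕ → ℤ} (j : ℕ) (h : ¬ (p : ℤ) ∣ e j) :
    cartier (X e : Laurent p) = 0 := by
  rw [cartier, lin_X, if_neg]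
  rintro ⟨f, rfl⟩
  exact h ⟨f j, by simp⟩

theorem cartier_X_of_dvd {e : ℕ → ℤ} (h : ∀ j, (p : ℤ) ∣ e j) :
    ∃ f, e = p • f ∧ cartier (X e : Laurent p) = X f := by
  choose f hf using h
  have : e = p • f := by ext j; simp [hf j]
  exact ⟨f, this, by rw [this, cartier_X_smul]⟩

theorem cartier_pow_mul (g f : Laurent p) : cartier (g ^ p * f) = g * cartier f := by
  have hp : (p : ℤ) ≠ 0 := by exact_mod_cast (Fact.out : p.Prime).ne_zero
  induction g using induction with
  | hadd g g' h h' => rw [add_pow_char, add_mul, map_add, h, h', add_mul]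
  | hsmul c g h => rw [smul_pow_char, smul_mul_assoc, map_smul, h, smul_mul_assoc]
  | hX e =>
    induction f using induction with
    | hadd f f' h h' => rw [mul_add, map_add, h, h', map_add, mul_add]
    | hsmul c f h => rw [mul_smul_comm, map_smul, h, map_smul, mul_smul_comm]
    | hX f =>
      rw [X_pow, X_mul]
      by_cases hf : ∀ j, (p : ℤ) ∣ f j
      · obtain ⟨f, rfl, -⟩ := cartier_X_of_dvd hf
        rw [← smul_add, cartier_X_smul, cartier_X_smul, X_mul]
      · push Not at hf
        obtain ⟨j, hj⟩ := hf
        rw [cartier_X_eq_zero j hj, cartier_X_eq_zero j, mul_zero]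
        rw [Pi.add_apply, Pi.smul_apply, nsmul_eq_mul, dvd_add_right (dvd_mul_right _ _)]
        exact hj

theorem cartier_pow (g : Laurent p) : cartier (g ^ p) = g := by
  have h := cartier_pow_mul g 1
  have h1 : cartier (1 : Laurent p) = 1 := by
    have := cartier_X_smul (p := p) 0
    rwa [smul_zero, X_zero] at this
  rwa [mul_one, h1, mul_one] at h

/-- In `x_s (x_s + x_{s+1}) ^ r` with `r < p`, multiplied by a monomial of `pairAlg s`, a `p`-th
power can occur only if `r = p - 1`, and then it is a `p`-th power of `x_s` times an invariant. -/
theorem cartier_mem_pairRel {s : ℕ} {f : Laurent p} (hf : f ∈ pairRel p s) :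
    cartier f ∈ pairRel p s := by
  have hpr : p.Prime := Fact.out
  obtain ⟨f, hf, rfl⟩ := hf
  refine pairAlg_induction (P := fun f => cartier (LinearMap.mulLeft (ZMod p) (x s) f) ∈ _) hf ?_
    (by simp) (fun f g hf hg => by simpa [mul_add] using add_mem hf hg)
    (fun c f hf => by simpa using Submodule.smul_mem _ c hf)
  · intro e n he
    simp only [LinearMap.mulLeft_apply]
    have hsplit : x s * (X e * (x s + x (s + 1)) ^ n)
        = ((x s + x (s + 1)) ^ (n / p)) ^ p
          * (x s * X e * (x s + x (s + 1) : Laurent p) ^ (n % p)) := by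
      conv_lhs => rw [← Nat.div_add_mod' n p, pow_add, pow_mul]
      ring
    rw [hsplit, cartier_pow_mul]
    refine mul_mem_pairRel (pow_mem (add_mem_pairAlg s) _) ?_
    rw [add_pow, Finset.mul_sum, map_sum]
    refine sum_mem fun a ha => ?_
    rw [Finset.mem_range] at ha
    have hmod := Nat.mod_lt n hpr.pos
    -- Only the power `x_s ^ (p - 1)` contributes: the exponent of `x_s` is `a + 1` mod `p`.
    have hmon : x s * X e * (x s ^ a * x (s + 1) ^ (n % p - a) * ((n % p).choose a : Laurent p))
        = ((n % p).choose a : ZMod p) • X (Pi.single s (((a + 1 : ℕ) : ℤ)) + e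
          + Pi.single (s + 1) (((n % p - a : ℕ) : ℤ))) := by
      rw [← X_mul, ← X_mul, ← x_pow, ← x_pow, Algebra.smul_def, map_natCast]
      ring
    rw [hmon, map_smul]
    refine Submodule.smul_mem _ _ ?_
    set e' : ℕ → ℤ := Pi.single s (((a + 1 : ℕ) : ℤ)) + e
          + Pi.single (s + 1) (((n % p - a : ℕ) : ℤ)) with he'
    have hs : e' s = a + 1 + p * e (s + 1) := by simp [he', he]
    have hs1 : e' (s + 1) = e (s + 1) + (n % p - a : ℕ) := by simp [he']
    by_cases hd : ∀ j, (p : ℤ) ∣ e' j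
    · obtain ⟨f, hf, hc⟩ := cartier_X_of_dvd hd
      have h1 := hd s
      rw [hs, dvd_add_left (dvd_mul_right _ _)] at h1
      have h2 : p ∣ a + 1 := by exact_mod_cast h1
      have h3 : a + 1 = p := le_antisymm (by omega) (Nat.le_of_dvd (by omega) h2)
      have h4 : n % p - a = 0 := by omega
      rw [hf, h4] at hs1
      rw [hf] at hs
      simp only [Pi.smul_apply, nsmul_eq_mul, Nat.cast_zero, add_zero] at hs hs1
      have hp0 : (p : ℤ) ≠ 0 := by exact_mod_cast hpr.ne_zero
      have h5 : f s = p * f (s + 1) + 1 := by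
        apply mul_left_cancel₀ hp0
        rw [hs, hs1]
        have : (a : ℤ) + 1 = p := by exact_mod_cast h3
        linear_combination this
      rw [hc, show (X f : Laurent p) = x s * X (f - Pi.single s 1) by
        rw [x, X_mul, add_sub_cancel]]
      exact x_mul_mem_pairRel (X_mem_pairAlg (by simp [h5]))
    · push Not at hd
      obtain ⟨j, hj⟩ := hd
      rw [cartier_X_eq_zero j hj]
      exact zero_mem _

theorem cartier_mem_relations {m : ℕ} {f : Laurent p} (hf : f ∈ relations p m) :
    cartier f ∈ relations p m := by
  refine relations_induction (P := fun f => cartier f ∈ relations p m) hf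
    (fun s h f hf => pairRel_le_relations h (cartier_mem_pairRel hf)) (by simp) ?_
  intro f g hf hg
  simpa using add_mem hf hg

/-- The map `λ` preserves the relations, because `x_s ^ p x_{s+1}` is invariant. -/
theorem pow_mul_mem_relations {m : ℕ} {f : Laurent p} (hf : f ∈ relations p m) :
    f ^ p * X (allOnes m) ∈ relations p m := by
  refine relations_induction (P := fun f => f ^ p * X (allOnes m) ∈ relations p m) hf ?_
    (by simp [(Fact.out : p.Prime).ne_zero])
    (fun f g hf hg => by simpa [add_pow_char, add_mul] using add_mem hf hg)
  · intro s h f hf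
    obtain ⟨f, hf, rfl⟩ := hf
    have hfp : f ^ p ∈ pairAlg p s := Subalgebra.pow_mem _ hf p
    have : (x s * f) ^ p * X (allOnes m)
        = x s * (f ^ p * X (Pi.single s ((p : ℤ) - 1) + allOnes m)) := by
      rw [mul_left_comm (x s), mul_pow, x_pow, mul_assoc, mul_left_comm, x, X_mul, X_mul]
      congr 2
      ext j
      rcases eq_or_ne j s with rfl | hj
      · simp only [Pi.add_apply, Pi.single_eq_same]
        ring
      · simp [hj]
    simp only [LinearMap.mulLeft_apply]
    rw [this]
    refine pairRel_le_relations h (x_mul_mem_pairRel (mul_mem hfp (X_mem_pairAlg ?_)))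
    simp [allOnes, h, show s < m by omega]

end Laurent

namespace Laurent

variable {p : ℕ}

/-! ### Dickson polynomials and a section of the Cartier operator -/

/-- The polynomial `∑ x_{i_1}^{p^(k-1)} x_{i_2}^{p^(k-2)} ⋯ x_{i_k}` over `i_1 < ⋯ < i_k < m`.
It plays the role of a Dickson invariant: it lies in `pairAlg s` whenever `s + 1 < m`. -/
noncomputable def dickson (p : ℕ) : ℕ → ℕ → Laurent p
  | 0, _ => 1
  | _ + 1, 0 => 0
  | k + 1, m + 1 => dickson p (k + 1) m + dickson p k m ^ p * x m

theorem dickson_succ_succ (k m : ℕ) :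
    dickson p (k + 1) (m + 1) = dickson p (k + 1) m + dickson p k m ^ p * x m := by
  rw [dickson]

theorem dickson_zero (m : ℕ) : dickson p 0 m = 1 := by
  rw [dickson]

/-- The Laurent polynomials in which all exponents of `x_j` are divisible by `p`. -/
noncomputable def frobAlg (p j : ℕ) : Subalgebra (ZMod p) (Laurent p) :=
  Algebra.adjoin (ZMod p) {f | ∃ e : ℕ → ℤ, (p : ℤ) ∣ e j ∧ f = X e}

theorem X_mem_frobAlg {j : ℕ} {e : ℕ → ℤ} (h : (p : ℤ) ∣ e j) : (X e : Laurent p) ∈ frobAlg p j :=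
  Algebra.subset_adjoin ⟨e, h, rfl⟩

theorem x_mem_frobAlg {i j : ℕ} (h : i ≠ j) : (x i : Laurent p) ∈ frobAlg p j :=
  X_mem_frobAlg (by simp [h.symm])

variable [Fact p.Prime]

theorem dickson_eq_zero {k m : ℕ} (h : m < k) : dickson p k m = 0 := by
  induction m generalizing k with
  | zero =>
    obtain ⟨k, rfl⟩ := Nat.exists_eq_succ_of_ne_zero h.ne'
    rw [Nat.succ_eq_add_one, dickson]
  | succ m ih =>
    obtain ⟨k, rfl⟩ := Nat.exists_eq_succ_of_ne_zero (show k ≠ 0 by omega)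
    rw [Nat.succ_eq_add_one, dickson_succ_succ, ih (by omega), ih (by omega),
      zero_pow (Fact.out : p.Prime).ne_zero, zero_mul, add_zero]

theorem dickson_self_succ (m : ℕ) : dickson p (m + 1) (m + 1) = dickson p m m ^ p * x m := by
  rw [dickson_succ_succ, dickson_eq_zero m.lt_succ_self, zero_add]

theorem dickson_self (m : ℕ) :
    dickson p m m = X (fun j => if j < m then (p : ℤ) ^ (m - 1 - j) else 0) := by
  induction m with
  | zero => exact dickson_zero 0
  | succ m ih =>
    rw [dickson_self_succ, ih, X_pow, x, X_mul]
    congr 1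
    ext j
    rcases lt_trichotomy j m with h | rfl | h
    · obtain ⟨i, rfl⟩ := Nat.exists_eq_add_of_lt h
      simp [pow_succ', Nat.add_assoc]
    · simp
    · simp [h.ne', not_lt.2 h.le, show ¬ j < m + 1 by omega]

theorem dickson_self_eq_prod (m : ℕ) :
    dickson p m m = ∏ i ∈ Finset.range m, x i * dickson p i i ^ (p - 1) := by
  induction m with
  | zero => exact dickson_zero 0
  | succ m ih =>
    rw [Finset.prod_range_succ, ← ih, dickson_self_succ]
    rw [← pow_sub_one_mul (Fact.out : p.Prime).ne_zero]
    ring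

theorem dickson_mem_pairAlg (k : ℕ) {m s : ℕ} (h : m ≠ s + 1) : dickson p k m ∈ pairAlg p s := by
  have hx : ∀ {m j}, j ≠ s → j ≠ s + 1 → (∀ k, dickson p k m ∈ pairAlg p s) →
      ∀ k, dickson p (k + 1) m + dickson p k m ^ p * x j ∈ pairAlg p s := fun h1 h2 hd k =>
    add_mem (hd _) (mul_mem (pow_mem (hd _) _) (x_mem_pairAlg h1 h2))
  have hle : ∀ m, m ≤ s → ∀ k, dickson p k m ∈ pairAlg p s := by
    intro m
    induction m with
    | zero =>
      rintro - (_ | k)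
      · rw [dickson_zero]; exact one_mem _
      · rw [dickson]; exact zero_mem _
    | succ m ih =>
      rintro hm (_ | k)
      · rw [dickson_zero]; exact one_mem _
      · rw [dickson_succ_succ]
        exact hx (by omega) (by omega) (ih (by omega)) k
  have hge : ∀ r k, dickson p k (s + 2 + r) ∈ pairAlg p s := by
    intro r
    induction r with
    | zero =>
      rintro (_ | _ | k)
      · rw [dickson_zero]; exact one_mem _
      · rw [add_zero, dickson_succ_succ, dickson_succ_succ, dickson_zero, dickson_zero, one_pow,
          one_mul, one_mul, add_assoc]
        exact add_mem (hle s le_rfl _) (add_mem_pairAlg s)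
      · -- `x_s` and `x_{s+1}` enter through `x_s + x_{s+1}` and `x_s ^ p x_{s+1}` only.
        have : dickson p (k + 2) (s + 2) = dickson p (k + 2) s
            + dickson p (k + 1) s ^ p * (x s + x (s + 1))
            + (dickson p k s ^ p) ^ p * (x s ^ p * x (s + 1)) := by
          rw [dickson_succ_succ, dickson_succ_succ, dickson_succ_succ, add_pow_char, mul_pow]
          ring
        rw [add_zero, this]
        have hd := hle s le_rfl
        exact add_mem (add_mem (hd _) (mul_mem (pow_mem (hd _) _) (add_mem_pairAlg s)))
          (mul_mem (pow_mem (pow_mem (hd _) _) _) (pow_mul_mem_pairAlg s))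
    | succ r ih =>
      rintro (_ | k)
      · rw [dickson_zero]; exact one_mem _
      · rw [← add_assoc, dickson_succ_succ]
        exact hx (by omega) (by omega) ih k
  rcases lt_or_gt_of_ne h with h | h
  · exact hle m (by omega) k
  · obtain ⟨r, rfl⟩ := Nat.exists_eq_add_of_le (show s + 2 ≤ m by omega)
    exact hge r k

theorem pow_mem_frobAlg (j : ℕ) (f : Laurent p) : f ^ p ∈ frobAlg p j := by
  induction f using induction with
  | hX e => rw [X_pow]; exact X_mem_frobAlg (by simp)
  | hadd f g hf hg => rw [add_pow_char]; exact add_mem hf hg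
  | hsmul c f hf => rw [smul_pow_char]; exact Subalgebra.smul_mem _ hf c

theorem cartier_x_pow_mul {j a : ℕ} (ha : ¬ p ∣ a) {f : Laurent p} (hf : f ∈ frobAlg p j) :
    cartier (x j ^ a * f) = 0 := by
  let W : Submodule (ZMod p) (Laurent p) :=
    Submodule.span (ZMod p) {g | ∃ e : ℕ → ℤ, ¬ (p : ℤ) ∣ e j ∧ g = X e}
  have hW : ∀ g ∈ W, g * f ∈ W := by
    unfold frobAlg at hf
    induction hf using Algebra.adjoin_induction with
    | mem f hf =>
      obtain ⟨d, hd, rfl⟩ := hf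
      intro g hg
      induction hg using Submodule.span_induction with
      | mem g hg =>
        obtain ⟨e, he, rfl⟩ := hg
        exact Submodule.subset_span ⟨e + d, by rwa [Pi.add_apply, dvd_add_left hd], X_mul e d⟩
      | zero => rw [zero_mul]; exact zero_mem _
      | add g g' _ _ h h' => rw [add_mul]; exact add_mem h h'
      | smul c g _ h => rw [smul_mul_assoc]; exact Submodule.smul_mem _ c h
    | algebraMap c =>
      intro g hg
      rw [Algebra.algebraMap_eq_smul_one, mul_smul_comm, mul_one]
      exact Submodule.smul_mem _ c hg
    | add f f' _ _ h h' => intro g hg; rw [mul_add]; exact add_mem (h g hg) (h' g hg)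
    | mul f f' _ _ h h' => intro g hg; rw [← mul_assoc]; exact h' _ (h g hg)
  have hker : W ≤ LinearMap.ker (cartier (p := p)) := by
    rw [Submodule.span_le]
    rintro _ ⟨e, he, rfl⟩
    exact cartier_X_eq_zero j he
  refine hker (hW _ ?_)
  rw [x_pow]
  exact Submodule.subset_span ⟨_, by simpa [Int.natCast_dvd_natCast] using ha, rfl⟩

/-- The part of `x_j (x_j u + v) ^ (p - 1)` in which the exponent of `x_j` is divisible by `p`
is `(x_j ^ p) u ^ (p - 1)`. -/
theorem cartier_mul_add_pow {j : ℕ} {u v f : Laurent p} (hu : u ∈ frobAlg p j)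
    (hv : v ∈ frobAlg p j) (hf : f ∈ frobAlg p j) :
    cartier (x j * (u * x j + v) ^ (p - 1) * f) = cartier (x j ^ p * u ^ (p - 1) * f) := by
  have hp := (Fact.out : p.Prime).pos
  have hterm : ∀ a, x j * ((u * x j) ^ a * v ^ (p - 1 - a) * ((p - 1).choose a : Laurent p)) * f
      = x j ^ (a + 1) * (u ^ a * v ^ (p - 1 - a) * ((p - 1).choose a : Laurent p) * f) :=
    fun a => by ring
  rw [add_pow, Finset.mul_sum, Finset.sum_mul, Finset.sum_range_succ, map_add, map_sum,
    Finset.sum_eq_zero, zero_add]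
  · congr 1
    rw [hterm, Nat.sub_add_cancel hp]
    simp [mul_assoc]
  · intro a ha
    rw [Finset.mem_range] at ha
    rw [hterm]
    refine cartier_x_pow_mul (fun h => ?_) (mul_mem (mul_mem (mul_mem (pow_mem hu _)
      (pow_mem hv _)) (natCast_mem _ _)) hf)
    have := Nat.le_of_dvd (by omega) h
    omega

theorem dickson_mem_frobAlg {j k : ℕ} (m : ℕ) (h : j + 1 < k) : dickson p k m ∈ frobAlg p j := by
  obtain ⟨k, rfl⟩ := Nat.exists_eq_succ_of_ne_zero (show k ≠ 0 by omega)
  rw [Nat.succ_eq_add_one] at *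
  induction m with
  | zero => rw [dickson]; exact zero_mem _
  | succ m ih =>
    rcases eq_or_ne m j with rfl | hm
    · rw [dickson_eq_zero h]; exact zero_mem _
    · rw [dickson_succ_succ]
      exact add_mem ih (mul_mem (pow_mem_frobAlg _ _) (x_mem_frobAlg hm))

theorem exists_dickson_succ_eq {j m : ℕ} (h : j < m) :
    ∃ v ∈ frobAlg p j, dickson p (j + 1) m = dickson p j j ^ p * x j + v := by
  induction m, h using Nat.le_induction with
  | base => exact ⟨0, zero_mem _, by rw [Nat.succ_eq_add_one, dickson_self_succ, add_zero]⟩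
  | succ m hm ih =>
    obtain ⟨v, hv, h⟩ := ih
    refine ⟨v + dickson p j m ^ p * x m,
      add_mem hv (mul_mem (pow_mem_frobAlg _ _) (x_mem_frobAlg (by omega))), ?_⟩
    rw [dickson_succ_succ, h, add_assoc]

/-- The product of the `dickson k m ^ (p - 1)` for `1 ≤ k ≤ m`. It lies in `pairAlg s` for all
`s + 1 < m`, and the only monomial of `dicksonProd m * x_0 ⋯ x_{m-1}` that is a `p`-th power is
the `p`-th power of the monomial `dickson m m`. -/
noncomputable def dicksonProd (p m : ℕ) : Laurent p :=
  ∏ i ∈ Finset.range m, dickson p (i + 1) m ^ (p - 1)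

theorem dicksonProd_mem_pairAlg {m s : ℕ} (h : s + 1 < m) : dicksonProd p m ∈ pairAlg p s :=
  prod_mem fun _ _ => pow_mem (dickson_mem_pairAlg _ h.ne') _

theorem cartier_dicksonProd_mul (m : ℕ) :
    cartier (dicksonProd p m * X (allOnes m)) = dickson p m m := by
  -- The variables are treated one after the other, each time by `cartier_mul_add_pow`.
  have stage : ∀ j ≤ m, cartier (dicksonProd p m * X (allOnes m))
      = cartier ((∏ i ∈ Finset.range j, x i * dickson p i i ^ (p - 1)) ^ p
          * ∏ i ∈ Finset.Ico j m, x i * dickson p (i + 1) m ^ (p - 1)) := by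
    intro j
    induction j with
    | zero =>
      intro _
      rw [Finset.range_zero, Finset.prod_empty, one_pow, one_mul, ← Finset.range_eq_Ico,
        Finset.prod_mul_distrib, X_allOnes, dicksonProd, mul_comm]
    | succ j ih =>
      intro hj
      obtain ⟨v, hv, hd⟩ := exists_dickson_succ_eq (p := p) (show j < m by omega)
      have htail : ∏ i ∈ Finset.Ico (j + 1) m, x i * dickson p (i + 1) m ^ (p - 1)
          ∈ frobAlg p j := by
        refine prod_mem fun i hi => ?_
        rw [Finset.mem_Ico] at hi
        exact mul_mem (x_mem_frobAlg (by omega)) (pow_mem (dickson_mem_frobAlg _ (by omega)) _)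
      rw [ih (by omega), Finset.prod_eq_prod_Ico_succ_bot (show j < m by omega), hd,
        cartier_pow_mul, cartier_mul_add_pow (pow_mem_frobAlg _ _) hv htail, ← cartier_pow_mul,
        Finset.prod_range_succ]
      congr 1
      ring
  rw [stage m le_rfl, Finset.Ico_self, Finset.prod_empty, mul_one, cartier_pow,
    ← dickson_self_eq_prod]

/-- Multiplication by `dicksonProd m` followed by the Cartier operator inverts
`f ↦ f ^ p * x_0 ⋯ x_{m-1}` up to the invertible monomial `dickson m m`. -/
theorem mem_relations_of_pow_mul {m : ℕ} {f : Laurent p}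
    (hf : f ^ p * X (allOnes m) ∈ relations p m) : f ∈ relations p m := by
  have h1 : cartier (dicksonProd p m * (f ^ p * X (allOnes m))) ∈ relations p m :=
    cartier_mem_relations (mul_mem_relations (fun _ => dicksonProd_mem_pairAlg) hf)
  rw [mul_left_comm, cartier_pow_mul, cartier_dicksonProd_mul, dickson_self] at h1
  set w : ℕ → ℤ := fun j => if j < m then (p : ℤ) ^ (m - 1 - j) else 0 with hw
  have h2 : X (-w) * (f * X w) ∈ relations p m := by
    refine mul_mem_relations (fun s hs => X_mem_pairAlg ?_) h1
    simp only [Pi.neg_apply, hw, if_pos hs, if_pos (show s < m by omega)]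
    rw [mul_neg, ← pow_succ', show m - 1 - s = m - 1 - (s + 1) + 1 by omega]
  rwa [mul_left_comm, X_mul, neg_add_cancel, X_zero, mul_one] at h2

end Laurent

open Laurent

variable {p : ℕ}

/-! ### From words to Laurent polynomials -/

/-- The word `z_{ε_1,i_1} ⋯ z_{ε_m,i_m}` of the free algebra. -/
noncomputable def word (p : ℕ) (w : List Label) : FreeAlgebra (ZMod p) Label :=
  (w.map fun a => gen p a.1 a.2).prod

theorem word_append (u v : List Label) : word p (u ++ v) = word p u * word p v := by
  simp [word]

theorem word_induction {P : FreeAlgebra (ZMod p) Label → Prop} (f : FreeAlgebra (ZMod p) Label)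
    (hword : ∀ w, P (word p w)) (hadd : ∀ f g, P f → P g → P (f + g))
    (hsmul : ∀ (c : ZMod p) f, P f → P (c • f)) : P f := by
  have hspan : f ∈ Submodule.span (ZMod p) (Set.range (word p)) := by
    induction f using FreeAlgebra.induction with
    | grade0 c =>
      rw [Algebra.algebraMap_eq_smul_one]
      exact Submodule.smul_mem _ c (Submodule.subset_span ⟨[], by simp [word]⟩)
    | grade1 a => exact Submodule.subset_span ⟨[a], by simp [word, gen]⟩
    | add f g hf hg => exact add_mem hf hg
    | mul f g hf hg =>
      have := Submodule.mul_mem_mul hf hg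
      rw [Submodule.span_mul_span] at this
      refine Submodule.span_mono ?_ this
      rintro _ ⟨_, ⟨u, rfl⟩, _, ⟨v, rfl⟩, rfl⟩
      exact ⟨u ++ v, word_append u v⟩
  refine Submodule.span_induction (p := fun f _ => P f) ?_ ?_ (fun f g _ _ => hadd f g)
    (fun c f _ => hsmul c f) hspan
  · rintro _ ⟨w, rfl⟩
    exact hword w
  · simpa using hsmul 0 _ (hword [])

/-- The exponents of the monomial that corresponds to the indices `i_0, …, i_{m-1}`. -/
def exps (l : List ℤ) : ℕ → ℤ := fun j => -l.getD j 0

/-- The monomial of a word of length `m` in which exactly one `ε` is `1`; other words have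
value `0`. The position of that `ε` is forgotten. -/
noncomputable def wordVal (p m : ℕ) (w : List Label) : Laurent p :=
  if w.length = m ∧ (w.map fun a => (a.1 : ℕ)).sum = 1 then X (exps (w.map Prod.snd)) else 0

/-- The linear extension of `wordVal` to the free algebra. -/
noncomputable def freeVal (p m : ℕ) : FreeAlgebra (ZMod p) Label →ₗ[ZMod p] Laurent p :=
  Finsupp.linearCombination (ZMod p) (fun w : FreeMonoid Label => wordVal p m w.toList) ∘ₗ
    (MonoidAlgebra.coeffLinearEquiv (ZMod p) :
      MonoidAlgebra (ZMod p) (FreeMonoid Label) ≃ₗ[ZMod p] _).toLinearMap ∘ₗ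
    (FreeAlgebra.equivMonoidAlgebraFreeMonoid (R := ZMod p) (X := Label)).toLinearMap

theorem freeVal_word (m : ℕ) (w : List Label) : freeVal p m (word p w) = wordVal p m w := by
  have h : FreeAlgebra.equivMonoidAlgebraFreeMonoid (word p w)
      = MonoidAlgebra.of (ZMod p) (FreeMonoid Label) (FreeMonoid.ofList w) := by
    induction w with
    | nil => simp [word, MonoidAlgebra.one_def]
    | cons a w ih =>
      rw [← List.singleton_append, word_append, map_mul, ih, FreeMonoid.ofList_append, map_mul]
      congr 1
      simp [word, gen, FreeAlgebra.equivMonoidAlgebraFreeMonoid]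
  simp only [freeVal, LinearMap.comp_apply, AlgEquiv.toLinearMap_apply, h]
  simp

/-- The monomial `x_s ^ (-pk) x_{s+1} ^ (-k)`. -/
noncomputable def pairMon (p s : ℕ) (k : ℤ) : Laurent p :=
  X (Pi.single s (-(p * k)) + Pi.single (s + 1) (-k))

theorem pairMon_mem (s : ℕ) (k : ℤ) : pairMon p s k ∈ pairAlg p s :=
  X_mem_pairAlg (by simp)

theorem pairMon_mul (s : ℕ) (k : ℤ) (n j : ℕ) (h : j ≤ n) :
    pairMon p s k * (x s ^ j * x (s + 1) ^ (n - j))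
      = X (Pi.single s (-(p * k - j)) + Pi.single (s + 1) (-(k - n + j))) := by
  rw [pairMon, x_pow, x_pow, X_mul, X_mul, Nat.cast_sub h]
  congr 1
  ext i
  simp only [Pi.add_apply, Pi.single_apply]
  split_ifs <;> ring

theorem pairMon_mul' (s : ℕ) (k : ℤ) (n j : ℕ) (h : j ≤ n) :
    pairMon p s k * (x s * (x s ^ j * x (s + 1) ^ (n - j)))
      = X (Pi.single s (-(p * k - 1 - j)) + Pi.single (s + 1) (-(k - n + j))) := by
  rw [mul_left_comm, pairMon_mul s k n j h, x, X_mul]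
  congr 1
  ext i
  simp only [Pi.add_apply, Pi.single_apply]
  split_ifs <;> ring

theorem exps_append_pair (u v : List ℤ) (a b : ℤ) :
    exps (u ++ [a, b] ++ v)
      = exps (u ++ [0, 0] ++ v) + (Pi.single u.length (-a) + Pi.single (u.length + 1) (-b)) := by
  ext j
  simp only [exps, Pi.add_apply, Pi.single_apply, List.append_assoc, List.getD_eq_getElem?_getD]
  rcases lt_or_ge j u.length with h | h
  · simp [List.getElem?_append_left h, h.ne, show j ≠ u.length + 1 by omega]
  · obtain ⟨i, rfl⟩ := Nat.exists_eq_add_of_le h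
    rw [List.getElem?_append_right h, List.getElem?_append_right h]
    rcases i with _ | _ | i
    · simp
    · simp
    · simp

theorem exps_append_zero_zero (u v : List ℤ) :
    exps (u ++ [0, 0] ++ v) u.length = 0 ∧ exps (u ++ [0, 0] ++ v) (u.length + 1) = 0 := by
  simp [exps, List.getD_eq_getElem?_getD]

theorem freeVal_word_mul_pair (m : ℕ) (u v : List Label) (ε δ : Fin 2) (i k : ℤ) :
    freeVal p m (word p u * (gen p ε i * gen p δ k) * word p v)
      = if (u.length + 2 + v.length = m ∧ (u.map fun a => (a.1 : ℕ)).sum + ((ε : ℕ) + δ)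
          + (v.map fun a => (a.1 : ℕ)).sum = 1)
        then X (exps (u.map Prod.snd ++ [0, 0] ++ v.map Prod.snd))
          * X (Pi.single u.length (-i) + Pi.single (u.length + 1) (-k)) else 0 := by
  have h : word p u * (gen p ε i * gen p δ k) * word p v
      = word p (u ++ [(ε, i), (δ, k)] ++ v) := by
    rw [word_append, word_append]
    simp [word]
  have h2 := exps_append_pair (u.map Prod.snd) (v.map Prod.snd) i k
  rw [List.length_map] at h2
  have hlen : (u ++ [(ε, i), (δ, k)] ++ v).length = u.length + 2 + v.length := by
    simp
    omega
  have hsum : ((u ++ [(ε, i), (δ, k)] ++ v).map fun a => (a.1 : ℕ)).sum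
      = (u.map fun a => (a.1 : ℕ)).sum + ((ε : ℕ) + δ) + (v.map fun a => (a.1 : ℕ)).sum := by
    simp [add_assoc]
  have hsnd : (u ++ [(ε, i), (δ, k)] ++ v).map Prod.snd
      = u.map Prod.snd ++ [i, k] ++ v.map Prod.snd := by simp
  rw [h, freeVal_word, wordVal, X_mul, ← h2, hlen, hsum, hsnd]

section Relations

variable [Fact p.Prime]

theorem ademPoly_mem_pairAlg (hp : p ≠ 2) (s n : ℕ) :
    ademPoly (p := p) n (x s : Laurent p) (x (s + 1)) ∈ pairAlg p s := by
  induction n using Nat.strong_induction_on with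
  | _ n ih =>
    rcases n with _ | n
    · rw [ademPoly_zero]; exact one_mem _
    · rw [← sub_eq_of_eq_add (add_mul_ademPoly hp n (x s : Laurent p) (x (s + 1)))]
      refine sub_mem (mul_mem (add_mem_pairAlg s) (ih n n.lt_succ_self)) ?_
      split_ifs with h
      · exact mul_mem (pow_mul_mem_pairAlg s) (ih _ (by omega))
      · exact zero_mem _

theorem pairMon_mul_ademPoly (s : ℕ) (k : ℤ) (n : ℕ) :
    pairMon p s k * ademPoly (p := p) n (x s) (x (s + 1))
      = X (Pi.single s (-(p * k - n)) + Pi.single (s + 1) (-k))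
        + ∑ j ∈ Finset.range (n + 1), ademCoeff p n j •
          X (Pi.single s (-(p * k - j)) + Pi.single (s + 1) (-(k - n + j))) := by
  have h := pairMon_mul (p := p) s k n n le_rfl
  rw [Nat.sub_self, pow_zero, mul_one, sub_add_cancel] at h
  rw [ademPoly, mul_add, h, Finset.mul_sum]
  congr 1
  refine Finset.sum_congr rfl fun j hj => ?_
  rw [mul_smul_comm, pairMon_mul s k n j (Nat.lt_succ_iff.1 (Finset.mem_range.1 hj))]

theorem pairMon_mul_ademPoly' (s : ℕ) (k : ℤ) (n : ℕ) :
    pairMon p s k * ademPoly' (p := p) n (x s) (x (s + 1))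
      = ∑ j ∈ Finset.range (n + 1), ademCoeff' p n j •
          X (Pi.single s (-(p * k - j)) + Pi.single (s + 1) (-(k - n + j))) := by
  rw [ademPoly', Finset.mul_sum]
  refine Finset.sum_congr rfl fun j hj => ?_
  rw [mul_smul_comm, pairMon_mul s k n j (Nat.lt_succ_iff.1 (Finset.mem_range.1 hj))]

theorem pairMon_mul_x_mul_ademPoly (s : ℕ) (k : ℤ) (n : ℕ) :
    pairMon p s k * (x s * ademPoly (p := p) n (x s) (x (s + 1)))
      = X (Pi.single s (-(p * k - 1 - n)) + Pi.single (s + 1) (-k))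
        + ∑ j ∈ Finset.range (n + 1), ademCoeff p n j •
          X (Pi.single s (-(p * k - 1 - j)) + Pi.single (s + 1) (-(k - n + j))) := by
  have h := pairMon_mul' (p := p) s k n n le_rfl
  rw [Nat.sub_self, pow_zero, mul_one, sub_add_cancel] at h
  rw [ademPoly, mul_add, mul_add, h, Finset.mul_sum, Finset.mul_sum]
  congr 1
  refine Finset.sum_congr rfl fun j hj => ?_
  rw [mul_smul_comm, mul_smul_comm,
    pairMon_mul' s k n j (Nat.lt_succ_iff.1 (Finset.mem_range.1 hj))]

/-- The relations `R(ε,k,n)` belong to `pairRel`. -/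
theorem pairMon_mul_x_mul_mem (hp : p ≠ 2) (s : ℕ) (k : ℤ) (n : ℕ) :
    pairMon p s k * (x s * ademPoly (p := p) n (x s) (x (s + 1))) ∈ pairRel p s :=
  mul_mem_pairRel (pairMon_mem s k) (x_mul_mem_pairRel (ademPoly_mem_pairAlg hp s n))

/-- The relations `S(0,k,n)` hold when `ε` is forgotten. -/
theorem pairMon_mul_sub_mem (hp : p ≠ 2) (s : ℕ) (k : ℤ) (n : ℕ) :
    pairMon p s k * (ademPoly (p := p) n (x s) (x (s + 1))
      - ademPoly' (p := p) n (x s) (x (s + 1))) ∈ pairRel p s := by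
  rcases n with _ | n
  · rw [ademPoly_zero, ademPoly'_zero, sub_self, mul_zero]
    exact zero_mem _
  · rw [ademPoly'_succ, sub_sub_cancel]
    exact pairMon_mul_x_mul_mem hp s k n

theorem freeVal_word_mul_adem (hp : p ≠ 2) (m : ℕ) (u v : List Label)
    {r r' : FreeAlgebra (ZMod p) Label} (hr : AdemRel p r r') :
    freeVal p m (word p u * r * word p v) ∈ relations p m := by
  let T : FreeAlgebra (ZMod p) Label →ₗ[ZMod p] Laurent p :=
    freeVal p m ∘ₗ LinearMap.mulRight (ZMod p) (word p v) ∘ₗ LinearMap.mulLeft (ZMod p) (word p u)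
  have hT : ∀ ε δ : Fin 2, ∀ i k, T (gen p ε i * gen p δ k) = _ :=
    freeVal_word_mul_pair m u v
  change T r ∈ _
  -- The factor coming from `u` and `v` lies in `pairAlg`.
  have hmem : ∀ f ∈ pairRel p u.length, u.length + 2 + v.length = m →
      X (exps (u.map Prod.snd ++ [0, 0] ++ v.map Prod.snd)) * f ∈ relations p m := by
    intro f hf hm
    refine pairRel_le_relations (by omega) (mul_mem_pairRel (X_mem_pairAlg ?_) hf)
    have := exps_append_zero_zero (u.map Prod.snd) (v.map Prod.snd)
    rw [List.length_map] at this
    rw [this.1, this.2, mul_zero]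
  induction hr with
  | R ε k n =>
    rw [relR, map_add, map_sum]
    simp only [map_smul, hT]
    split_ifs with h
    · simp only [← mul_smul_comm, ← Finset.mul_sum, ← mul_add]
      refine hmem _ ?_ h.1
      have := pairMon_mul_x_mul_mem hp u.length k n
      rwa [pairMon_mul_x_mul_ademPoly] at this
    · simp
  | S ε k n =>
    rw [relS, map_add, map_add, map_smul, map_sum, map_sum]
    simp only [map_smul, hT]
    have h01 : ε = 0 ∨ ε = 1 := by omega
    rcases h01 with rfl | rfl
    · simp only [Fin.val_zero, Fin.val_one, Nat.cast_zero, sub_zero, one_smul, add_zero, zero_add]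
      split_ifs with h
      · simp only [← mul_smul_comm, ← Finset.mul_sum, ← mul_add]
        refine hmem _ ?_ h.1
        have := pairMon_mul_sub_mem hp u.length k n
        rw [mul_sub, pairMon_mul_ademPoly, pairMon_mul_ademPoly'] at this
        convert this using 1
        rw [sub_eq_add_neg (_ + _), ← Finset.sum_neg_distrib]
        congr 1
        refine Finset.sum_congr rfl fun j _ => ?_
        rw [← neg_smul, ademCoeff', pow_succ]
        congr 1
        ring
      · simp
    · -- Two of the `ε` are `1`.
      have h2 : ∀ a b : ℕ, ¬ (a + 2 + b = 1) := by omega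
      simp [h2]

theorem freeVal_mul_adem (hp : p ≠ 2) (m : ℕ) (f g : FreeAlgebra (ZMod p) Label)
    {r r' : FreeAlgebra (ZMod p) Label} (hr : AdemRel p r r') :
    freeVal p m (f * r * g) ∈ relations p m := by
  induction f using word_induction with
  | hadd f f' h h' => rw [add_mul, add_mul, map_add]; exact add_mem h h'
  | hsmul c f h => rw [smul_mul_assoc, smul_mul_assoc, map_smul]; exact Submodule.smul_mem _ c h
  | hword u =>
    induction g using word_induction with
    | hadd g g' h h' => rw [mul_add, map_add]; exact add_mem h h'
    | hsmul c g h => rw [mul_smul_comm, map_smul]; exact Submodule.smul_mem _ c h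
    | hword v => exact freeVal_word_mul_adem hp m u v hr

/-- `freeVal m` induces a linear map from `𝒬(p)` to the Laurent polynomials modulo the
relations. -/
theorem freeVal_mem_of_mk_eq_zero (hp : p ≠ 2) (m : ℕ) {f : FreeAlgebra (ZMod p) Label}
    (hf : RingQuot.mkAlgHom (ZMod p) (AdemRel p) f = 0) : freeVal p m f ∈ relations p m := by
  have hrel : ∀ a b, RingQuot.Rel (AdemRel p) a b →
      ∀ f g, freeVal p m (f * (a - b) * g) ∈ relations p m := by
    intro a b h
    induction h with
    | of h =>
      intro f g
      cases h
      all_goals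
        rw [sub_zero]
        exact freeVal_mul_adem hp m f g (by constructor)
    | add_left _ ih => intro f g; rw [add_sub_add_right_eq_sub]; exact ih f g
    | @mul_left a b c _ ih =>
      intro f g
      have := ih f (c * g)
      rwa [show f * (a * c - b * c) * g = f * (a - b) * (c * g) by noncomm_ring]
    | @mul_right a b c _ ih =>
      intro f g
      have := ih (f * a) g
      rwa [show f * (a * b - a * c) * g = f * a * (b - c) * g by noncomm_ring]
  have heqv : Relation.EqvGen (RingQuot.Rel (AdemRel p)) f 0 := by
    rw [← map_zero (RingQuot.mkAlgHom (ZMod p) (AdemRel p))] at hf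
    simp only [RingQuot.mkAlgHom_def, RingQuot.mkRingHom_def] at hf
    exact Quot.eqvGen_exact (congrArg RingQuot.toQuot hf)
  have hsub : ∀ a b, Relation.EqvGen (RingQuot.Rel (AdemRel p)) a b →
      freeVal p m (a - b) ∈ relations p m := by
    intro a b h
    induction h with
    | rel a b h => simpa using hrel a b h 1 1
    | refl a => simp
    | symm a b _ ih => rw [← neg_sub, map_neg]; exact neg_mem ih
    | trans a b c _ _ ih ih' => rw [← sub_add_sub_cancel a b c, map_add]; exact add_mem ih ih'
  simpa using hsub f 0 heqv

end Relations

/-! ### From Laurent polynomials back to the universal Steenrod algebra -/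

/-- The monomial of `𝒬(p)` that corresponds to the exponents `e_0, …, e_{m-1}`; the first letter
has `ε = 1`, the others have `ε = 0`. -/
noncomputable def evalMon (p m : ℕ) (e : ℕ → ℤ) : Q p :=
  ((List.range m).map fun j => z p (if j = 0 then 1 else 0) (-e j)).prod

/-- The letters in positions `s` and `s + 1` of a monomial. -/
theorem evalMon_add_pair (s r : ℕ) (e : ℕ → ℤ) (a b : ℤ) :
    evalMon p (s + 2 + r) (e + (Pi.single s a + Pi.single (s + 1) b))
      = evalMon p s e
        * (z p (if s = 0 then 1 else 0) (-(e s + a)) * z p 0 (-(e (s + 1) + b)))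
        * ((List.range r).map fun j => z p 0 (-e (s + 2 + j))).prod := by
  simp only [evalMon, List.range_add, List.map_append, List.prod_append, List.map_map]
  congr 1
  · congr 1
    · congr 1
      refine List.map_congr_left fun j hj => ?_
      rw [List.mem_range] at hj
      simp [hj.ne, show j ≠ s + 1 by omega]
    · simp [List.range_succ]
  · congr 1
    refine List.map_congr_left fun j _ => ?_
    simp [show s + 2 + j ≠ s by omega, show s + 2 + j ≠ s + 1 by omega]

theorem evalMon_exps (i : ℤ) (t : List ℤ) :
    evalMon p (t.length + 1) (exps (i :: t)) = mono p i t := by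
  have ht : (List.range t.length).map (fun j => z p 0 (t.getD j 0)) = t.map (z p 0) := by
    apply List.ext_getElem
    · simp
    · intro n h _
      have hn : n < t.length := by simpa using h
      simp [hn]
  simp only [evalMon, List.range_succ_eq_map, List.map_cons, List.prod_cons, List.map_map, mono]
  rw [← ht]
  simp [exps, Function.comp_def]

variable [Fact p.Prime]

theorem lin_evalMon_mul_ademPoly {m s : ℕ} (hs : s + 1 < m) {e : ℕ → ℤ}
    (he : e s = p * e (s + 1) + 1) (n : ℕ) :
    lin (p := p) (evalMon p m) (X e * ademPoly (p := p) n (x s) (x (s + 1))) = 0 := by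
  obtain ⟨r, rfl⟩ := Nat.exists_eq_add_of_le (show s + 2 ≤ m by omega)
  set ε : Fin 2 := if s = 0 then 1 else 0 with hε
  set A := evalMon p s e
  set B := ((List.range r).map fun j => z p 0 (-e (s + 2 + j))).prod
  set k : ℤ := -e (s + 1) with hk
  have hpair : ∀ j ≤ n, lin (p := p) (evalMon p (s + 2 + r)) (X e * (x s ^ j * x (s + 1) ^ (n - j)))
      = A * (z p ε (p * k - 1 - j) * z p 0 (k - n + j)) * B := by
    intro j hj
    rw [x_pow, x_pow, X_mul, X_mul, lin_X, evalMon_add_pair, he, Nat.cast_sub hj]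
    congr 4 <;> rw [hk] <;> ring
  have hlead := hpair n le_rfl
  rw [Nat.sub_self, pow_zero, mul_one, sub_add_cancel] at hlead
  have hR : z p ε (p * k - 1 - n) * z p 0 k + ∑ j ∈ Finset.range (n + 1), ademCoeff p n j •
      (z p ε (p * k - 1 - j) * z p 0 (k - n + j)) = 0 := by
    have h := RingQuot.mkAlgHom_rel (ZMod p) (AdemRel.R (p := p) ε k n)
    rw [relR, map_add, map_mul, map_sum, map_zero] at h
    simp only [map_smul, map_mul] at h
    exact h
  have hsum : ∀ j ∈ Finset.range (n + 1),
      lin (p := p) (evalMon p (s + 2 + r)) (X e * ademCoeff p n j • (x s ^ j * x (s + 1) ^ (n - j)))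
        = A * (ademCoeff p n j • (z p ε (p * k - 1 - j) * z p 0 (k - n + j))) * B := by
    intro j hj
    rw [mul_smul_comm, map_smul, hpair j (Nat.lt_succ_iff.1 (Finset.mem_range.1 hj)),
      mul_smul_comm, smul_mul_assoc]
  rw [ademPoly, mul_add, map_add, hlead, Finset.mul_sum, map_sum, Finset.sum_congr rfl hsum,
    ← Finset.sum_mul, ← Finset.mul_sum, ← add_mul, ← mul_add, hR, mul_zero, zero_mul]

/-- The relations among Laurent monomials hold in `𝒬(p)`. -/
theorem lin_evalMon_eq_zero (hp : p ≠ 2) {m : ℕ} {f : Laurent p} (hf : f ∈ relations p m) :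
    lin (p := p) (evalMon p m) f = 0 := by
  -- By the recursion for `ademPoly`, powers of `x_s + x_{s+1}` reduce to the
  -- polynomials `ademPoly`.
  have key : ∀ s, s + 1 < m → ∀ n q : ℕ, ∀ e : ℕ → ℤ, e s = p * e (s + 1) + 1 →
      lin (p := p) (evalMon p m)
        (X e * ((x s + x (s + 1)) ^ n * ademPoly (p := p) q (x s) (x (s + 1)))) = 0 := by
    intro s hs n
    induction n with
    | zero =>
      intro q e he
      rw [pow_zero, one_mul]
      exact lin_evalMon_mul_ademPoly hs he q
    | succ n ih =>
      intro q e he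
      rw [pow_succ, mul_assoc, add_mul_ademPoly hp, mul_add, mul_add, map_add, ih _ e he, zero_add]
      split_ifs with h
      · have hmon : (X e : Laurent p) * ((x s + x (s + 1)) ^ n * (x s ^ p * x (s + 1)
            * ademPoly (p := p) (q - p) (x s) (x (s + 1))))
            = X (e + (Pi.single s (p : ℤ) + Pi.single (s + 1) 1))
              * ((x s + x (s + 1)) ^ n * ademPoly (p := p) (q - p) (x s) (x (s + 1))) := by
          rw [← X_mul, ← X_mul, ← x_pow, ← x]
          ring
        rw [hmon]
        refine ih _ _ ?_
        simp [he]
        ring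
      · simp
  refine relations_induction (P := fun f => lin (p := p) (evalMon p m) f = 0) hf ?_ (map_zero _)
    (fun f g hf hg => by rw [map_add, hf, hg, add_zero])
  rintro s hs _ ⟨f, hf, rfl⟩
  refine pairAlg_induction
    (P := fun f => lin (evalMon p m) (LinearMap.mulLeft (ZMod p) (x s : Laurent p) f) = 0) hf ?_
    (by simp)
    (fun f g hf hg => by rw [map_add, map_add, hf, hg, add_zero])
    (fun c f hf => by rw [map_smul, map_smul, hf, smul_zero])
  intro e n he
  have := key s hs n 0 (Pi.single s 1 + e) (by simp [he, add_comm])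
  rwa [ademPoly_zero, mul_one, ← X_mul, ← x, mul_assoc] at this

end UnivSteenrod

namespace UnivSteenrod

open Laurent

variable {p : ℕ}

/-! ### Linear combinations of the monomials spanning `V_0` -/

/-- The index set of the monomials `z_{1,i} z_{0,t_1} ⋯ z_{0,t_r}` with `r ≥ 1`. -/
abbrev Idx : Type := ℤ × {t : List ℤ // t ≠ []}

/-- The monomial of `V_0` with a given index. -/
noncomputable def monoV (p : ℕ) (a : Idx) : V p 0 :=
  ⟨mono p a.1 a.2.1, mono_mem_V_zero p a.1 a.2.1 a.2.2⟩

/-- The map `i ↦ p i - 1` on all indices. -/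
def shift (p : ℕ) (a : Idx) : Idx :=
  (p * a.1 - 1, ⟨a.2.1.map fun k => (p : ℤ) * k - 1, by simpa using a.2.2⟩)

/-- The part of word length `m` of a formal linear combination, as a Laurent polynomial. -/
noncomputable def comp (p m : ℕ) : (Idx →₀ ZMod p) →ₗ[ZMod p] Laurent p :=
  Finsupp.linearCombination (ZMod p) fun a =>
    if a.2.1.length + 1 = m then X (exps (a.1 :: a.2.1)) else 0

theorem mono_eq_mk_word (i : ℤ) (t : List ℤ) :
    mono p i t = RingQuot.mkAlgHom (ZMod p) (AdemRel p)
      (word p ((1, i) :: t.map fun k => (0, k))) := by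
  rw [word, map_list_prod]
  simp only [mono, z, List.map_cons, List.prod_cons, List.map_map]
  rfl

theorem span_range_monoV : Submodule.span (ZMod p) (Set.range (monoV p)) = ⊤ := by
  apply Submodule.map_injective_of_injective (V p 0).injective_subtype
  rw [Submodule.map_span, Submodule.map_subtype_top]
  change _ = Submodule.span _ _
  congr 1
  ext f
  constructor
  · rintro ⟨_, ⟨a, rfl⟩, rfl⟩
    exact ⟨a.1, a.2.1, a.2.2, by simp [monoV, alpha]⟩
  · rintro ⟨i, t, ht, rfl⟩
    exact ⟨_, ⟨(i, ⟨t, ht⟩), rfl⟩, by simp [monoV, alpha]⟩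

variable [Fact p.Prime]

theorem comp_mem_of_linearCombination_eq_zero (hp : p ≠ 2) {w : Idx →₀ ZMod p}
    (hw : Finsupp.linearCombination (ZMod p) (fun a : Idx => mono p a.1 a.2.1) w = 0) (m : ℕ) :
    comp p m w ∈ relations p m := by
  let lift : Idx → FreeAlgebra (ZMod p) Label := fun a =>
    word p ((1, a.1) :: a.2.1.map fun k => (0, k))
  have h1 : RingQuot.mkAlgHom (ZMod p) (AdemRel p)
      (Finsupp.linearCombination (ZMod p) lift w) = 0 := by
    rw [← hw, ← AlgHom.toLinearMap_apply, Finsupp.apply_linearCombination]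
    congr 2
    ext a
    exact (mono_eq_mk_word a.1 a.2.1).symm
  have h2 := freeVal_mem_of_mk_eq_zero hp m h1
  rw [Finsupp.apply_linearCombination] at h2
  convert h2 using 1
  rw [comp]
  congr 1
  congr 1
  ext1 a
  simp only [Function.comp_apply, lift, freeVal_word, wordVal]
  simp [Function.comp_def]

theorem linearCombination_eq_zero_of_comp_mem (hp : p ≠ 2) {w : Idx →₀ ZMod p}
    (hw : ∀ m, comp p m w ∈ relations p m) :
    Finsupp.linearCombination (ZMod p) (fun a : Idx => mono p a.1 a.2.1) w = 0 := by
  have hsum : ∑ m ∈ w.support.image (fun a : Idx => a.2.1.length + 1),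
      lin (evalMon p m) (comp p m w)
      = Finsupp.linearCombination (ZMod p) (fun a : Idx => mono p a.1 a.2.1) w := by
    simp only [comp, Finsupp.linearCombination_apply, Finsupp.sum, map_sum, map_smul]
    rw [Finset.sum_comm]
    refine Finset.sum_congr rfl fun a ha => ?_
    rw [← Finset.smul_sum]
    congr 1
    rw [Finset.sum_eq_single (a.2.1.length + 1), if_pos rfl, lin_X, evalMon_exps]
    · intro m _ hm
      rw [if_neg hm.symm, map_zero]
    · intro h
      exact absurd (Finset.mem_image_of_mem _ ha) h
  rw [← hsum]
  exact Finset.sum_eq_zero fun m _ => lin_evalMon_eq_zero hp (hw m)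

theorem comp_shift (m : ℕ) (w : Idx →₀ ZMod p) :
    comp p m (Finsupp.lmapDomain (ZMod p) (ZMod p) (shift p) w)
      = comp p m w ^ p * X (allOnes m) := by
  induction w using Finsupp.induction_linear with
  | zero => simp [(Fact.out : p.Prime).ne_zero]
  | add v w hv hw => rw [map_add, map_add, hv, hw, map_add, add_pow_char, add_mul]
  | single a c =>
    rw [Finsupp.lmapDomain_apply, Finsupp.mapDomain_single]
    simp only [comp, Finsupp.linearCombination_single]
    rw [smul_pow_char, smul_mul_assoc]
    congr 1
    rcases a with ⟨i, t, ht⟩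
    simp only [shift, List.length_map]
    split_ifs with h
    · rw [X_pow, X_mul]
      congr 1
      ext j
      have hlen : (i :: t).length = m := by simpa using h
      have hcons : (p * i - 1 : ℤ) :: t.map (fun k => (p : ℤ) * k - 1)
          = (i :: t).map fun k => (p : ℤ) * k - 1 := rfl
      rw [hcons]
      rw [Pi.add_apply, Pi.smul_apply, nsmul_eq_mul]
      simp only [exps, allOnes, List.getD_eq_getElem?_getD, List.getElem?_map]
      rcases lt_or_ge j m with hj | hj
      · rw [List.getElem?_eq_getElem (hlen ▸ hj), if_pos hj]
        simp only [Option.map_some, Option.getD_some]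
        ring
      · rw [List.getElem?_eq_none (hlen ▸ hj), if_neg (not_lt.2 hj)]
        simp
    · simp [(Fact.out : p.Prime).ne_zero]

/-- A linear combination of monomials of `V_0` vanishes if and only if the shifted one does. -/
theorem linearCombination_shift_eq_zero_iff (hp : p ≠ 2) (w : Idx →₀ ZMod p) :
    Finsupp.linearCombination (ZMod p) (monoV p)
        (Finsupp.lmapDomain (ZMod p) (ZMod p) (shift p) w) = 0
      ↔ Finsupp.linearCombination (ZMod p) (monoV p) w = 0 := by
  have hval : ∀ w : Idx →₀ ZMod p, Finsupp.linearCombination (ZMod p) (monoV p) w = 0 ↔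
      ∀ m, comp p m w ∈ relations p m := by
    intro w
    rw [← (V p 0).injective_subtype.eq_iff, Finsupp.apply_linearCombination, map_zero]
    exact ⟨comp_mem_of_linearCombination_eq_zero hp, linearCombination_eq_zero_of_comp_mem hp⟩
  simp only [hval, comp_shift]
  exact forall_congr' fun m => ⟨mem_relations_of_pow_mul, pow_mul_mem_relations⟩

/-- The shift of all indices is well defined on `V_0` and injective. -/
theorem exists_shift_end (hp : p ≠ 2) : ∃ lam : Module.End (ZMod p) (V p 0),
    (∀ a, lam (monoV p a) = monoV p (shift p a)) ∧ Function.Injective lam := by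
  set E := Finsupp.linearCombination (ZMod p) (monoV p)
  set S := Finsupp.lmapDomain (ZMod p) (ZMod p) (shift p)
  have hE : Function.Surjective E := by
    rw [← LinearMap.range_eq_top, Finsupp.range_linearCombination, span_range_monoV]
  have hker : ∀ w, E (S w) = 0 ↔ E w = 0 := linearCombination_shift_eq_zero_iff hp
  let lam : Module.End (ZMod p) (V p 0) :=
    (LinearMap.ker E).liftQ (E ∘ₗ S) (fun w hw => (hker w).2 hw) ∘ₗ
      (E.quotKerEquivOfSurjective hE).symm.toLinearMap
  have hlam : ∀ w, lam (E w) = E (S w) := by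
    intro w
    have : (E.quotKerEquivOfSurjective hE).symm (E w) = (LinearMap.ker E).mkQ w :=
      (LinearEquiv.symm_apply_eq _).2 rfl
    simp only [lam, LinearMap.comp_apply, LinearEquiv.coe_coe, this]
    rfl
  refine ⟨lam, fun a => ?_, ?_⟩
  · have := hlam (Finsupp.single a 1)
    simpa [E, S] using this
  · rw [← LinearMap.ker_eq_bot, LinearMap.ker_eq_bot']
    intro v hv
    obtain ⟨w, rfl⟩ := hE v
    rw [hlam] at hv
    exact (hker w).1 hv

theorem alpha_succ (s : ℕ) : alpha p (s + 1) = p * alpha p s + 1 := by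
  have h2 : (2 : ℤ) ≤ p := by exact_mod_cast (Fact.out : p.Prime).two_le
  apply mul_right_cancel₀ (show (p : ℤ) - 1 ≠ 0 by omega)
  rw [alpha_mul, add_mul, mul_assoc, alpha_mul]
  ring

end UnivSteenrod

/-! ### The powers of `λ` -/

theorem proposition4p2 (p : ℕ) [Fact p.Prime] (hp : p ≠ 2) :
    ∃ lam : Module.End (ZMod p) (UnivSteenrod.V p 0),
      (∀ (i : ℤ) (t : List ℤ) (ht : t ≠ []),
        (lam ⟨UnivSteenrod.mono p i t, UnivSteenrod.mono_mem_V_zero p i t ht⟩ :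
            UnivSteenrod.Q p) =
          UnivSteenrod.mono p ((p : ℤ) * i - 1) (t.map fun k => (p : ℤ) * k - 1)) ∧
      Function.Injective lam ∧
      ∀ s : ℕ,
        (LinearMap.range (lam ^ s)).map (UnivSteenrod.V p 0).subtype = UnivSteenrod.V p s ∧
          UnivSteenrod.V p s ≤ UnivSteenrod.V p 0 := by
  obtain ⟨lam, hlam, hinj⟩ := UnivSteenrod.exists_shift_end hp
  refine ⟨lam, fun i t ht => congrArg Subtype.val (hlam (i, ⟨t, ht⟩)), hinj, fun s => ?_⟩
  have hpow : ∀ a : UnivSteenrod.Idx, ((lam ^ s) (UnivSteenrod.monoV p a) : UnivSteenrod.Q p)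
      = UnivSteenrod.mono p ((p : ℤ) ^ s * a.1 - UnivSteenrod.alpha p s)
          (a.2.1.map fun k => (p : ℤ) ^ s * k - UnivSteenrod.alpha p s) := by
    induction s with
    | zero => intro a; simp [UnivSteenrod.monoV, UnivSteenrod.alpha]
    | succ s ih =>
      intro a
      rw [pow_succ, Module.End.mul_apply, hlam, ih]
      simp only [UnivSteenrod.shift, List.map_map, UnivSteenrod.alpha_succ]
      have : ∀ k : ℤ, (p : ℤ) ^ s * (p * k - 1) - UnivSteenrod.alpha p s
          = (p : ℤ) ^ (s + 1) * k - (p * UnivSteenrod.alpha p s + 1) := by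
        intro k
        linear_combination UnivSteenrod.alpha_mul p s
      simp only [Function.comp_def, this]
  have hrange : (LinearMap.range (lam ^ s)).map (UnivSteenrod.V p 0).subtype
      = UnivSteenrod.V p s := by
    rw [LinearMap.range_eq_map, ← UnivSteenrod.span_range_monoV, Submodule.map_span,
      Submodule.map_span]
    change _ = Submodule.span (ZMod p) (UnivSteenrod.U p s)
    congr 1
    ext f
    constructor
    · rintro ⟨_, ⟨_, ⟨a, rfl⟩, rfl⟩, rfl⟩
      exact ⟨a.1, a.2.1, a.2.2, hpow a⟩
    · rintro ⟨i, t, ht, rfl⟩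
      exact ⟨_, ⟨_, ⟨(i, ⟨t, ht⟩), rfl⟩, rfl⟩, hpow _⟩
  exact ⟨hrange, hrange ▸ Submodule.map_subtype_le _ _⟩
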